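/- Let $\mathbb X,\mathbb Y,\mathbb Z$ be finite-dimensional real Euclidean spaces, let $f_1:\mathbb Y\to(-\infty,+\infty]$ and $f_2:\mathbb Z\to(-\infty,+\infty]$ be proper closed convex functions, let $B_1:\mathbb Y\to\mathbb X$ and $B_2:\mathbb Z\to\mathbb X$ be linear operators with adjoints $B_1^*,B_2^*$, and let $c\in\mathbb X$. Consider the primal problem $$\min_{y\in\mathbb Y,\;z\in\mathbb Z}\ f_1(y)+f_2(z)\quad\text{subject to}\quad B_1y+B_2z=c \tag{1}$$ and its dual, in which $f_i^*$ denotes the Fenchel conjugate of $f_i$, $$\max_{x\in\mathbb X}\ -f_1^*(-B_1^*x)-f_2^*(-B_2^*x)-\langle c,x\rangle. \tag{2}$$ For $i=1,2$ let $\Sigma_{f_i}$ be a self-adjoint positive semidefinite operator such that, for all $u,\hat u\in\operatorname{dom}(f_i)$, $\phi\in\partial f_i(u)$ and $\hat\phi\in\partial f_i(\hat u)$, $$f_i(u)\ge f_i(\hat u)+\langle\hat\phi,u-\hat u\rangle+\tfrac12\|u-\hat u\|_{\Sigma_{f_i}}^2\quad\text{and}\quad\langle\phi-\hat\phi,u-\hat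 u\rangle\ge\|u-\hat u\|_{\Sigma_{f_i}}^2,$$ where $\|u\|_{M}^2:=\langle u,Mu\rangle$. Let $\mathcal T_1$ and $\mathcal T_2$ be self-adjoint positive semidefinite linear operators on $\mathbb Y$ and $\mathbb Z$, let $\sigma>0$, $\alpha\ge2$, $\rho\in(0,2]$, and let $w^0=(y^0,z^0,x^0)\in\operatorname{dom}(f_1)\times\operatorname{dom}(f_2)\times\mathbb X$. Put $\hat w^0:=w^0$ and write $$L_\sigma(y,z;x)=f_1(y)+f_2(z)+\langle x,B_1y+B_2z-c\rangle+\tfrac\sigma2\|B_1y+B_2z-c\|^2 .$$ The accelerated pADMM generates $w^k=(y^k,z^k,x^k)$, $\hat w^k$ and $\bar w^k=(\bar y^k,\bar z^k,\bar x^k)$ by performing, for $k=0,1,2,\dots$: 1. $\bar z^k\in\arg\min_{z\in\mathbb Z}\{L_\sigma(y^k,z;x^k)+\frac12\|z-z^k\|_{\mathcal T_2}^2\}$; 2. $\bar x^k=x^k+\sigma(B_1y^k+B_2\bar z^k-c)$; 3. $\bar y^k\in\arg\min_{y\in\mathbb Y}\{L_\sigma(y,\bar z^k;\bar x^k)+\frac12\|y-y^k\|_{\mathcal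 T_1}^2\}$; 4. $\hat w^{k+1}=(1-\rho)w^k+\rho\bar w^k$; 5. $w^{k+1}=w^k+\frac{\alpha}{2(k+\alpha)}(\hat w^{k+1}-w^k)+\frac{k}{k+\alpha}(\hat w^{k+1}-\hat w^k)$. In the two minimizations, the summand of $L_\sigma$ that does not depend on the minimization variable ($f_1(y^k)$ in step 1, $f_2(\bar z^k)$ in step 3) is omitted; this matters only if $y^k\notin\operatorname{dom}(f_1)$. Assume that * (Assumption 1) the KKT system $-B_1^*x\in\partial f_1(y)$, $-B_2^*x\in\partial f_2(z)$, $B_1y+B_2z-c=0$ has a solution $(y,z,x)$; * (Assumption 2) $\Sigma_{f_1}+B_1^*B_1+\mathcal T_1$ and $\Sigma_{f_2}+B_2^*B_2+\mathcal T_2$ are positive definite. Then the algorithm can be run (all minimizers in steps 1 and 3 exist), and the sequence $\bar w^k=(\bar y^k,\bar z^k,\bar x^k)$ that it generates converges to a point $w^*=(y^*,z^*,x^*)$ such that $(y^*,z^*)$ is a solution of problem (1) and $x^*$ is a solution of problem (2). -/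

import Mathlib

open scoped InnerProductSpace

namespace AccPADMM

section ConvexAnalysis

variable {E : Type*} [NormedAddCommGroup E] [InnerProductSpace ℝ E]

/-- A proper closed convex function `f : E → (-∞, +∞]`: it never takes the value `-∞`, it is not
identically `+∞`, its epigraph is convex, and it is lower semicontinuous. -/
structure ProperClosedConvex (f : E → EReal) : Prop where
  ne_bot : ∀ u, f u ≠ ⊥
  exists_ne_top : ∃ u, f u ≠ ⊤
  convex_epigraph : Convex ℝ {p : E × ℝ | f p.1 ≤ (p.2 : EReal)}
  lsc : LowerSemicontinuous f

/-- The effective domain `{u | f u < +∞}`. -/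
def effDom (f : E → EReal) : Set E := {u | f u < ⊤}

/-- The convex subdifferential `∂f(u)`; it is empty outside the effective domain. -/
def subdiff (f : E → EReal) (u : E) : Set E :=
  {φ | u ∈ effDom f ∧ ∀ v, f u + ((⟪φ, v - u⟫_ℝ : ℝ) : EReal) ≤ f v}

/-- The Fenchel conjugate `f^*(φ) = sup_u (⟨φ, u⟩ - f u)`. -/
noncomputable def conjugate (f : E → EReal) (φ : E) : EReal :=
  ⨆ u, (((⟪φ, u⟫_ℝ : ℝ) : EReal) - f u)

/-- The squared seminorm `‖v‖²_M = ⟨v, M v⟩` of a self-adjoint positive semidefinite `M`. -/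
noncomputable def sqSeminorm (M : E →ₗ[ℝ] E) (v : E) : ℝ := ⟪v, M v⟫_ℝ

/-- Self-adjoint and positive definite. -/
def PosDef (M : E →ₗ[ℝ] E) : Prop :=
  M.IsSymmetric ∧ ∀ v, v ≠ 0 → 0 < ⟪v, M v⟫_ℝ

/-- `S` is a self-adjoint positive semidefinite operator for which
`f v ≥ f u + ⟨ψ, v - u⟩ + ½ ‖v - u‖²_S` and `⟨φ - ψ, v - u⟩ ≥ ‖v - u‖²_S`
for all `v, u ∈ dom f`, `φ ∈ ∂f(v)`, `ψ ∈ ∂f(u)`. -/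
structure IsConvexityModulus (f : E → EReal) (S : E →ₗ[ℝ] E) : Prop where
  isPositive : S.IsPositive
  growth : ∀ v ∈ effDom f, ∀ u ∈ effDom f, ∀ φ ∈ subdiff f v, ∀ ψ ∈ subdiff f u,
    f u + ((⟪ψ, v - u⟫_ℝ + 1 / 2 * sqSeminorm S (v - u) : ℝ) : EReal) ≤ f v
  monotone : ∀ v ∈ effDom f, ∀ u ∈ effDom f, ∀ φ ∈ subdiff f v, ∀ ψ ∈ subdiff f u,
    sqSeminorm S (v - u) ≤ ⟪φ - ψ, v - u⟫_ℝ

end ConvexAnalysis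

/-- The data of the problem `min f₁(y) + f₂(z)` subject to `B₁ y + B₂ z = c`. -/
structure Problem (Y Z X : Type*)
    [NormedAddCommGroup Y] [InnerProductSpace ℝ Y]
    [NormedAddCommGroup Z] [InnerProductSpace ℝ Z]
    [NormedAddCommGroup X] [InnerProductSpace ℝ X] where
  f₁ : Y → EReal
  f₂ : Z → EReal
  B₁ : Y →ₗ[ℝ] X
  B₂ : Z →ₗ[ℝ] X
  c : X

namespace Problem

variable {Y Z X : Type*}
  [NormedAddCommGroup Y] [InnerProductSpace ℝ Y] [FiniteDimensional ℝ Y]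
  [NormedAddCommGroup Z] [InnerProductSpace ℝ Z] [FiniteDimensional ℝ Z]
  [NormedAddCommGroup X] [InnerProductSpace ℝ X] [FiniteDimensional ℝ X]

/-- `(y, z)` is an optimal solution of the primal problem. -/
def IsPrimalSolution (P : Problem Y Z X) (y : Y) (z : Z) : Prop :=
  (y ∈ effDom P.f₁ ∧ z ∈ effDom P.f₂ ∧ P.B₁ y + P.B₂ z = P.c) ∧
    ∀ y' z', P.B₁ y' + P.B₂ z' = P.c → P.f₁ y + P.f₂ z ≤ P.f₁ y' + P.f₂ z'

/-- The dual objective `-f₁^*(-B₁^* x) - f₂^*(-B₂^* x) - ⟨c, x⟩`. -/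
noncomputable def dualObjective (P : Problem Y Z X) (x : X) : EReal :=
  -conjugate P.f₁ (-(LinearMap.adjoint P.B₁ x)) - conjugate P.f₂ (-(LinearMap.adjoint P.B₂ x))
    - ((⟪P.c, x⟫_ℝ : ℝ) : EReal)

/-- `x` is an optimal solution of the dual problem (with a finite optimal value). -/
def IsDualSolution (P : Problem Y Z X) (x : X) : Prop :=
  ⊥ < P.dualObjective x ∧ ∀ x', P.dualObjective x' ≤ P.dualObjective x

/-- The KKT system `-B₁^* x ∈ ∂f₁(y)`, `-B₂^* x ∈ ∂f₂(z)`, `B₁ y + B₂ z - c = 0`. -/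
def IsKKT (P : Problem Y Z X) (y : Y) (z : Z) (x : X) : Prop :=
  -(LinearMap.adjoint P.B₁ x) ∈ subdiff P.f₁ y ∧
  -(LinearMap.adjoint P.B₂ x) ∈ subdiff P.f₂ z ∧
  P.B₁ y + P.B₂ z - P.c = 0

/-- The finite part `⟨x, B₁ y + B₂ z - c⟩ + (σ/2) ‖B₁ y + B₂ z - c‖²` of the augmented Lagrangian
`L_σ(y, z; x) = f₁(y) + f₂(z) + ⟨x, B₁ y + B₂ z - c⟩ + (σ/2) ‖B₁ y + B₂ z - c‖²`. -/
noncomputable def coupling (P : Problem Y Z X) (σ : ℝ) (y : Y) (z : Z) (x : X) : ℝ :=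
  ⟪x, P.B₁ y + P.B₂ z - P.c⟫_ℝ + σ / 2 * ‖P.B₁ y + P.B₂ z - P.c‖ ^ 2

/-- The objective `z ↦ L_σ(y, z; x) + ½ ‖z - z₀‖²_{T₂}` of the `z`-subproblem, without the summand
`f₁(y)`, which does not depend on `z` (and which is `+∞` when an extrapolated iterate `y` has left
the effective domain of `f₁`). -/
noncomputable def zObjective (P : Problem Y Z X) (T₂ : Z →ₗ[ℝ] Z) (σ : ℝ)
    (y : Y) (z₀ : Z) (x : X) (z : Z) : EReal :=
  P.f₂ z + ((P.coupling σ y z x + 1 / 2 * sqSeminorm T₂ (z - z₀) : ℝ) : EReal)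

/-- The objective `y ↦ L_σ(y, z; x) + ½ ‖y - y₀‖²_{T₁}` of the `y`-subproblem, without the summand
`f₂(z)`, which does not depend on `y`. -/
noncomputable def yObjective (P : Problem Y Z X) (T₁ : Y →ₗ[ℝ] Y) (σ : ℝ)
    (y₀ : Y) (z : Z) (x : X) (y : Y) : EReal :=
  P.f₁ y + ((P.coupling σ y z x + 1 / 2 * sqSeminorm T₁ (y - y₀) : ℝ) : EReal)

/-- The sequences `w^k = (y^k, z^k, x^k)`, `ŵ^k` and `w̄^k = (ȳ^k, z̄^k, x̄^k)` are generated by the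
accelerated pADMM from the initial point `w₀`. -/
structure IsAccPADMM (P : Problem Y Z X) (T₁ : Y →ₗ[ℝ] Y) (T₂ : Z →ₗ[ℝ] Z) (σ α ρ : ℝ)
    (w₀ : Y × Z × X) (w what wbar : ℕ → Y × Z × X) : Prop where
  init : w 0 = w₀
  init_hat : what 0 = w₀
  step_z : ∀ k, ∀ z, P.zObjective T₂ σ (w k).1 (w k).2.1 (w k).2.2 (wbar k).2.1 ≤
    P.zObjective T₂ σ (w k).1 (w k).2.1 (w k).2.2 z
  step_x : ∀ k, (wbar k).2.2 =
    (w k).2.2 + σ • (P.B₁ (w k).1 + P.B₂ (wbar k).2.1 - P.c)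
  step_y : ∀ k, ∀ y, P.yObjective T₁ σ (w k).1 (wbar k).2.1 (wbar k).2.2 (wbar k).1 ≤
    P.yObjective T₁ σ (w k).1 (wbar k).2.1 (wbar k).2.2 y
  step_hat : ∀ k, what (k + 1) = (1 - ρ) • w k + ρ • wbar k
  step_w : ∀ k : ℕ, w (k + 1) = w k + (α / (2 * ((k : ℝ) + α))) • (what (k + 1) - w k)
    + ((k : ℝ) / ((k : ℝ) + α)) • (what (k + 1) - what k)

end Problem

end AccPADMM

set_option linter.unusedSectionVars false

/-! The method is an accelerated fixed-point iteration of one nonexpansive map, seen through a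
degenerate metric. The form `σ⟨y, T₁ y'⟩ + σ⟨z, T₂ z'⟩ + ⟨σ B₁ y + x, σ B₁ y' + x'⟩` is only
semidefinite on `Y × Z × X`, so it is written as `⟨R w, R w'⟩` (`IsFactor`) and the dynamics is
moved to the range of `R`. Monotonicity of `∂f₁`, `∂f₂` makes a step `w ↦ wbar` firmly nonexpansive
there (`IsFactor.firm`). Positive definiteness makes `wbar` a Lipschitz function of `R w` alone
(`IsFactor.exists_lipschitz`). Hence the relaxed step induces a nonexpansive map `N`, whose fixed
points yield KKT points (`IsFactor.isKKT_of_eq`).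

The accelerated iteration of `N` is a Halpern iteration whose anchor `Z` drifts by `-γ (u - N u)`,
with `γ = α / 2 - 1`. A nonincreasing energy gives boundedness and a residual `O(1 / k)`, so cluster
points are fixed. If `γ = 0`, the anchor is constant and the limit is its projection onto the fixed
points. If `γ > 0`, the energies relative to two fixed points `p`, `q` differ by an affine function
of `⟨Z k, p - q⟩`; this quantity converges, therefore so does `⟨u k, p - q⟩`, and there is only one
cluster point.

Convergence of `R (w k)` passes to `wbar k` by the Lipschitz estimate. KKT points solve the primal
and dual problems by Fenchel–Young. -/

namespace AccPADMM

/-! ### Averaged recursions of real sequences -/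

/-- A nonnegative sequence with `(k + 1 + β) x (k + 1) ≤ (k + 1) x k + β e k` and
`limsup e ≤ 0` tends to zero. -/
theorem tendsto_zero_of_averaged_le {β : ℝ} (hβ : 1 ≤ β) {x e : ℕ → ℝ} (hx : ∀ k, 0 ≤ x k)
    (hrec : ∀ k : ℕ, ((k : ℝ) + 1 + β) * x (k + 1) ≤ ((k : ℝ) + 1) * x k + β * e k)
    (he : ∀ ε > 0, ∀ᶠ k in Filter.atTop, e k ≤ ε) :
    Filter.Tendsto x Filter.atTop (nhds 0) := by
  rw [Metric.tendsto_atTop]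
  intro ε hε
  obtain ⟨K, hK⟩ := Filter.eventually_atTop.1 (he (ε / 2) (by positivity))
  -- Once `e ≤ ε / 2`, the quantity `(k + 1) * max (x k - ε / 2) 0` no longer increases; `β ≥ 1` is
  -- what turns the factor `k + 1 + β` into `k + 2`. The excess over `ε / 2` is thus `O(1 / k)`.
  have hy : ∀ n, ((K + n : ℕ) + 1 : ℝ) * max (x (K + n) - ε / 2) 0 ≤
      ((K : ℝ) + 1) * max (x K - ε / 2) 0 := by
    intro n
    induction n with
    | zero => simp
    | succ n ih =>
      refine le_trans ?_ ih
      have h1 := hrec (K + n)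
      have h2 := hK (K + n) (by omega)
      have h3 : (0 : ℝ) ≤ ((K + n : ℕ) : ℝ) := by positivity
      rw [← add_assoc]
      generalize K + n = j at *
      push_cast
      rcases le_total (x (j + 1) - ε / 2) 0 with h | h
      · rw [max_eq_right h]
        have := le_max_right (x j - ε / 2) 0
        simpa using mul_nonneg (by positivity) this
      · rw [max_eq_left h]
        have h4 : ((j : ℝ) + 1) * (x j - ε / 2) ≤ ((j : ℝ) + 1) * max (x j - ε / 2) 0 :=
          mul_le_mul_of_nonneg_left (le_max_left _ _) (by positivity)
        nlinarith
  obtain ⟨n, hn⟩ := exists_nat_gt (((K : ℝ) + 1) * max (x K - ε / 2) 0 / (ε / 2))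
  refine ⟨K + n, fun k hk => ?_⟩
  obtain ⟨j, rfl⟩ := Nat.exists_eq_add_of_le (le_trans (Nat.le_add_right K n) hk)
  have hj : (n : ℝ) ≤ j := by exact_mod_cast (by omega : n ≤ j)
  have h1 := hy j
  rw [div_lt_iff₀ (by positivity)] at hn
  have h2 := le_max_left (x (K + j) - ε / 2) 0
  have h3 := le_max_right (x (K + j) - ε / 2) 0
  rw [Real.dist_eq, sub_zero, abs_of_nonneg (hx _)]
  by_contra! hcon
  have h4 : ε / 2 ≤ max (x (K + j) - ε / 2) 0 := by linarith
  have h5 : ((K + j : ℕ) + 1 : ℝ) * (ε / 2) ≤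
      ((K + j : ℕ) + 1 : ℝ) * max (x (K + j) - ε / 2) 0 :=
    mul_le_mul_of_nonneg_left h4 (by positivity)
  push_cast at h1 h5
  have hK0 : (0 : ℝ) ≤ K := by positivity
  nlinarith

theorem tendsto_of_averaged_eq {β l : ℝ} (hβ : 1 ≤ β) {r b : ℕ → ℝ}
    (hrec : ∀ k : ℕ, ((k : ℝ) + 1 + β) * r (k + 1) = ((k : ℝ) + 1) * r k + β * b k)
    (hb : Filter.Tendsto b Filter.atTop (nhds l)) :
    Filter.Tendsto r Filter.atTop (nhds l) := by
  rw [tendsto_iff_dist_tendsto_zero]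
  refine tendsto_zero_of_averaged_le (e := fun k => |b k - l|) hβ (fun k => dist_nonneg)
    (fun k => ?_) (fun ε hε => ?_)
  · have h1 : ((k : ℝ) + 1 + β) * (r (k + 1) - l) =
        ((k : ℝ) + 1) * (r k - l) + β * (b k - l) := by linarith [hrec k]
    have h2 := congrArg abs h1
    have hk : (0 : ℝ) < (k : ℝ) + 1 := by positivity
    rw [abs_mul, abs_of_pos (by linarith : (0 : ℝ) < (k : ℝ) + 1 + β)] at h2
    rw [Real.dist_eq, Real.dist_eq, h2]
    refine (abs_add_le _ _).trans_eq ?_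
    rw [abs_mul, abs_mul, abs_of_pos hk, abs_of_pos (by linarith : (0 : ℝ) < β)]
  · have := (Metric.tendsto_nhds.1 hb ε hε)
    filter_upwards [this] with k hk
    exact (Real.dist_eq _ _ ▸ hk).le

/-! ### Halpern-type iterations of nonexpansive maps -/

section FixedPoint

variable {H : Type*} [NormedAddCommGroup H] [InnerProductSpace ℝ H]

/-- The iteration `u (k + 1) = (Z (k + 1) + (k + 1) N (u k)) / (k + 1 + β)`, `β = 2 γ + 1`, of
Halpern type, whose anchor moves by `Z (k + 1) = Z k - γ (u k - N (u k))`. -/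
structure IsAnchored (N : H → H) (γ : ℝ) (u Z : ℕ → H) : Prop where
  step_u : ∀ k : ℕ, ((k : ℝ) + 1 + (2 * γ + 1)) • u (k + 1) =
    Z (k + 1) + ((k : ℝ) + 1) • N (u k)
  step_Z : ∀ k, Z (k + 1) = Z k - γ • (u k - N (u k))

/-- The energy of an anchored iteration relative to a point `p`. -/
noncomputable def anchoredEnergy (N : H → H) (γ : ℝ) (u Z : ℕ → H) (p : H) (k : ℕ) : ℝ :=
  ((k : ℝ) + (2 * γ + 1)) * ⟪u k - N (u k), (2 * γ + 1) • u k - Z k⟫_ℝ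
    + ((k : ℝ) + (2 * γ + 1)) * k / 2 * ‖u k - N (u k)‖ ^ 2
    + ‖Z k - (2 * γ + 1) • p‖ ^ 2

/-- Expanding `‖N a - N b‖² ≤ ‖a - b‖²` shows that `id - N` is 1/2-cocoercive, the only form in
which nonexpansiveness enters the energy estimates. -/
theorem half_sq_le_inner_of_nonexpansive {N : H → H} (hN : ∀ a b, ‖N a - N b‖ ≤ ‖a - b‖)
    (a b : H) :
    ‖(a - N a) - (b - N b)‖ ^ 2 / 2 ≤ ⟪(a - N a) - (b - N b), a - b⟫_ℝ := by
  have h1 : ‖N a - N b‖ ^ 2 ≤ ‖a - b‖ ^ 2 := by gcongr; exact hN a b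
  have h2 : N a - N b = (a - b) - ((a - N a) - (b - N b)) := by abel
  rw [h2, norm_sub_sq_real, real_inner_comm] at h1
  linarith

theorem half_sq_le_inner_of_fixed {N : H → H} (hN : ∀ a b, ‖N a - N b‖ ≤ ‖a - b‖)
    {p : H} (hp : N p = p) (a : H) :
    ‖a - N a‖ ^ 2 / 2 ≤ ⟪a - N a, a - p⟫_ℝ := by
  simpa [hp] using half_sq_le_inner_of_nonexpansive hN a p

/-- The fixed points of a nonexpansive map are cut out by closed half-spaces. -/
theorem fixed_iff_forall_inner {N : H → H} (hN : ∀ a b, ‖N a - N b‖ ≤ ‖a - b‖) (q : H) :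
    N q = q ↔ ∀ v, ‖v - N v‖ ^ 2 / 2 ≤ ⟪v - N v, v - q⟫_ℝ := by
  refine ⟨fun hq v => half_sq_le_inner_of_fixed hN hq v, fun h => ?_⟩
  have h1 := h q
  rw [sub_self, inner_zero_right] at h1
  have h2 : ‖q - N q‖ = 0 := by nlinarith [norm_nonneg (q - N q)]
  exact (sub_eq_zero.1 (norm_eq_zero.1 h2)).symm

theorem convex_fixedPoints {N : H → H} (hN : ∀ a b, ‖N a - N b‖ ≤ ‖a - b‖) :
    Convex ℝ {q | N q = q} := by
  intro p hp q hq s t hs ht hst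
  simp only [Set.mem_ofPred_eq, fixed_iff_forall_inner hN] at hp hq ⊢
  intro v
  have h1 : v - (s • p + t • q) = s • (v - p) + t • (v - q) := by
    rw [smul_sub, smul_sub, sub_add_sub_comm, ← add_smul, hst, one_smul]
  rw [h1, inner_add_right, inner_smul_right, inner_smul_right]
  nlinarith [mul_le_mul_of_nonneg_left (hp v) hs, mul_le_mul_of_nonneg_left (hq v) ht]

theorem continuous_of_nonexpansive {E : Type*} [NormedAddCommGroup E] {N : E → E} (hN : ∀ a b, ‖N a - N b‖ ≤ ‖a - b‖) :
    Continuous N :=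
  (LipschitzWith.of_dist_le_mul (K := 1) fun a b => by
    simpa [dist_eq_norm] using hN a b).continuous

namespace IsAnchored

variable {N : H → H} {γ : ℝ} {u Z : ℕ → H}

/-- Cocoercivity between consecutive iterates gives the decrease. The drift of the anchor leaves the
cross term `-2γ(2γ + 1)⟨a, u k - p⟩`, with `a = u k - N (u k)`, whose sign is controlled by
cocoercivity against the fixed point `p`. -/
theorem energy_succ_le (h : IsAnchored N γ u Z) (hN : ∀ a b, ‖N a - N b‖ ≤ ‖a - b‖)
    (hγ : 0 ≤ γ) {p : H} (hp : N p = p) (k : ℕ) :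
    anchoredEnergy N γ u Z p (k + 1) ≤ anchoredEnergy N γ u Z p k := by
  have hu := h.step_u k
  have hZ := h.step_Z k
  have h1 := half_sq_le_inner_of_nonexpansive hN (u (k + 1)) (u k)
  have hfix := half_sq_le_inner_of_fixed hN hp (u k)
  unfold anchoredEnergy
  have hNu : N (u k) = u k - (u k - N (u k)) := by abel
  rw [hNu] at hu
  push_cast
  have hk : (0 : ℝ) ≤ k := by positivity
  generalize u (k + 1) - N (u (k + 1)) = a' at *
  generalize u k - N (u k) = a at *
  generalize u (k + 1) = u' at *
  generalize u k = v at *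
  generalize Z (k + 1) = z' at *
  generalize Z k = z at *
  generalize (k : ℝ) = t at *
  have h2 : (t + 1) • (u' - v) = z' - (2 * γ + 1) • u' - (t + 1) • a := by
    have := hu
    rw [add_smul] at this
    linear_combination (norm := module) this
  have h3 : (t + 1 + (2 * γ + 1)) • ((2 * γ + 1) • u' - z') =
      (t + 1) • ((2 * γ + 1) • v - z - (γ + 1) • a) := by
    rw [smul_sub, smul_comm, hu, hZ]
    module
  have e2 := congrArg (fun w => ⟪a' - a, w⟫_ℝ) h2
  have e3 := congrArg (fun w => ⟪a, w⟫_ℝ) h3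
  have eZ : ‖z' - (2 * γ + 1) • p‖ ^ 2 = ‖z - (2 * γ + 1) • p‖ ^ 2
      - 2 * γ * ⟪a, z - (2 * γ + 1) • p⟫_ℝ + γ ^ 2 * ‖a‖ ^ 2 := by
    have : z' - (2 * γ + 1) • p = (z - (2 * γ + 1) • p) - γ • a := by rw [hZ]; abel
    rw [this, norm_sub_sq_real, inner_smul_right, norm_smul, mul_pow, real_inner_comm a,
      Real.norm_eq_abs, sq_abs]
    ring
  rw [eZ]
  have h1' := mul_le_mul_of_nonneg_left h1 (by linarith : 0 ≤ t + 1)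
  rw [norm_sub_sq_real] at h1'
  simp only [inner_sub_left, inner_sub_right, inner_smul_right, real_inner_self_eq_norm_sq]
    at e2 e3 h1' hfix ⊢
  have hc := real_inner_comm a a'
  rw [hc] at *
  have h1'' : (t + 1) / 2 * ‖a'‖ ^ 2 + ((2 * γ + 1) * ⟪a', u'⟫_ℝ - ⟪a', z'⟫_ℝ) ≤
      (t + 1) / 2 * ‖a‖ ^ 2 + ((2 * γ + 1) * ⟪a, u'⟫_ℝ - ⟪a, z'⟫_ℝ) := by
    linarith
  have h4 := mul_le_mul_of_nonneg_left h1'' (by linarith : 0 ≤ t + 1 + (2 * γ + 1))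
  have h5 := mul_le_mul_of_nonneg_left hfix (by positivity : 0 ≤ 2 * γ * (2 * γ + 1))
  have h6 : 0 ≤ γ * t * ‖a‖ ^ 2 := by positivity
  have h7 : 0 ≤ γ * (γ + 1) * ‖a‖ ^ 2 := by positivity
  linarith

/-- Cocoercivity at `p` supplies the missing `(2γ + 1) / 2` in the coefficient of the squared
residual, after which the energy contains a complete square. -/
theorem le_energy (hN : ∀ a b, ‖N a - N b‖ ≤ ‖a - b‖)
    (hγ : 0 ≤ γ) {p : H} (hp : N p = p) (u Z : ℕ → H) (k : ℕ) :
    ‖((k : ℝ) + (2 * γ + 1)) • (u k - N (u k)) - (Z k - (2 * γ + 1) • p)‖ ^ 2 / 2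
      + ‖Z k - (2 * γ + 1) • p‖ ^ 2 / 2 ≤ anchoredEnergy N γ u Z p k := by
  have hfix := half_sq_le_inner_of_fixed hN hp (u k)
  unfold anchoredEnergy
  have hk : (0 : ℝ) ≤ k := by positivity
  generalize u k - N (u k) = a at *
  rw [norm_sub_sq_real, norm_smul, mul_pow, Real.norm_eq_abs, sq_abs, inner_smul_left]
  have h5 := mul_le_mul_of_nonneg_left hfix
    (by positivity : 0 ≤ ((k : ℝ) + (2 * γ + 1)) * (2 * γ + 1))
  simp only [inner_sub_right, inner_smul_right, conj_trivial] at h5 ⊢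
  linarith

theorem energy_tendsto (h : IsAnchored N γ u Z) (hN : ∀ a b, ‖N a - N b‖ ≤ ‖a - b‖)
    (hγ : 0 ≤ γ) {p : H} (hp : N p = p) :
    ∃ l, Filter.Tendsto (anchoredEnergy N γ u Z p) Filter.atTop (nhds l) := by
  have hanti : Antitone (anchoredEnergy N γ u Z p) :=
    antitone_nat_of_succ_le (h.energy_succ_le hN hγ hp)
  exact ⟨_, tendsto_atTop_ciInf hanti ⟨0, by
    rintro _ ⟨k, rfl⟩
    exact le_trans (by positivity) (le_energy hN hγ hp u Z k)⟩⟩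

theorem anchor_bounded (h : IsAnchored N γ u Z) (hN : ∀ a b, ‖N a - N b‖ ≤ ‖a - b‖)
    (hγ : 0 ≤ γ) {p : H} (hp : N p = p) :
    ∃ C, ∀ k, ‖Z k - (2 * γ + 1) • p‖ ≤ C ∧
      ((k : ℝ) + (2 * γ + 1)) * ‖u k - N (u k)‖ ≤ C := by
  have hanti : Antitone (anchoredEnergy N γ u Z p) :=
    antitone_nat_of_succ_le (h.energy_succ_le hN hγ hp)
  set D := anchoredEnergy N γ u Z p 0
  have hD : ∀ k : ℕ, ‖((k : ℝ) + (2 * γ + 1)) • (u k - N (u k)) - (Z k - (2 * γ + 1) • p)‖ ^ 2 / 2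
      + ‖Z k - (2 * γ + 1) • p‖ ^ 2 / 2 ≤ D := fun k =>
    (le_energy hN hγ hp u Z k).trans (hanti (Nat.zero_le k))
  have h1 : ∀ k, ‖Z k - (2 * γ + 1) • p‖ ≤ Real.sqrt (2 * D) := fun k => by
    apply Real.le_sqrt_of_sq_le
    linarith [hD k, sq_nonneg
      ‖((k : ℝ) + (2 * γ + 1)) • (u k - N (u k)) - (Z k - (2 * γ + 1) • p)‖]
  have h2 : ∀ k : ℕ, ‖((k : ℝ) + (2 * γ + 1)) • (u k - N (u k)) - (Z k - (2 * γ + 1) • p)‖ ≤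
      Real.sqrt (2 * D) := fun k => by
    apply Real.le_sqrt_of_sq_le
    linarith [hD k, sq_nonneg ‖Z k - (2 * γ + 1) • p‖]
  refine ⟨2 * Real.sqrt (2 * D), fun k => ⟨?_, ?_⟩⟩
  · linarith [h1 k, Real.sqrt_nonneg (2 * D)]
  · have hk : (0 : ℝ) ≤ (k : ℝ) + (2 * γ + 1) := by positivity
    calc ((k : ℝ) + (2 * γ + 1)) * ‖u k - N (u k)‖
        = ‖((k : ℝ) + (2 * γ + 1)) • (u k - N (u k))‖ := by
          rw [norm_smul, Real.norm_of_nonneg hk]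
      _ ≤ ‖((k : ℝ) + (2 * γ + 1)) • (u k - N (u k)) - (Z k - (2 * γ + 1) • p)‖
          + ‖Z k - (2 * γ + 1) • p‖ := norm_le_norm_sub_add _ _
      _ ≤ _ := by linarith [h1 k, h2 k]

theorem residual_tendsto (h : IsAnchored N γ u Z) (hN : ∀ a b, ‖N a - N b‖ ≤ ‖a - b‖)
    (hγ : 0 ≤ γ) {p : H} (hp : N p = p) :
    Filter.Tendsto (fun k => u k - N (u k)) Filter.atTop (nhds 0) := by
  obtain ⟨C, hC⟩ := h.anchor_bounded hN hγ hp
  rw [tendsto_zero_iff_norm_tendsto_zero]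
  have h1 : Filter.Tendsto (fun k : ℕ => C / ((k : ℝ) + (2 * γ + 1))) Filter.atTop (nhds 0) :=
    Filter.Tendsto.div_atTop tendsto_const_nhds
      (Filter.tendsto_atTop_add_const_right _ _ tendsto_natCast_atTop_atTop)
  refine squeeze_zero (fun _ => norm_nonneg _) (fun k => ?_) h1
  rw [le_div_iff₀ (by positivity), mul_comm]
  exact (hC k).2

theorem bounded (h : IsAnchored N γ u Z) (hN : ∀ a b, ‖N a - N b‖ ≤ ‖a - b‖)
    (hγ : 0 ≤ γ) {p : H} (hp : N p = p) : ∃ C, ∀ k, ‖u k - p‖ ≤ C := by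
  obtain ⟨C, hC⟩ := h.anchor_bounded hN hγ hp
  refine ⟨max C ‖u 0 - p‖, fun k => ?_⟩
  induction k with
  | zero => exact le_max_right _ _
  | succ k ih =>
    have hk : (0 : ℝ) < (k : ℝ) + 1 + (2 * γ + 1) := by positivity
    -- Up to normalization, `u (k + 1) - p` is a weighted average of the bounded anchor error and `N
    -- (u k) - p`, so the bound propagates.
    have h1 : ((k : ℝ) + 1 + (2 * γ + 1)) • (u (k + 1) - p) =
        (Z (k + 1) - (2 * γ + 1) • p) + ((k : ℝ) + 1) • (N (u k) - p) := by
      rw [smul_sub, h.step_u k]; module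
    have h2 := congrArg norm h1
    rw [norm_smul, Real.norm_of_nonneg hk.le] at h2
    have h3 : ‖N (u k) - p‖ ≤ max C ‖u 0 - p‖ := by
      have := hN (u k) p
      rw [hp] at this
      exact this.trans ih
    have h4 := norm_add_le (Z (k + 1) - (2 * γ + 1) • p) (((k : ℝ) + 1) • (N (u k) - p))
    rw [norm_smul, Real.norm_of_nonneg (by positivity : (0 : ℝ) ≤ (k : ℝ) + 1)] at h4
    have h5 := (hC (k + 1)).1
    have h6 := le_max_left C ‖u 0 - p‖
    have h7 : ((k : ℝ) + 1) * ‖N (u k) - p‖ ≤ ((k : ℝ) + 1) * max C ‖u 0 - p‖ := by gcongr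
    have h8 : 0 ≤ max C ‖u 0 - p‖ := (norm_nonneg _).trans ih
    have h9 := mul_nonneg hγ h8
    refine le_of_mul_le_mul_left ?_ hk
    linarith

theorem fixed_of_cluster (h : IsAnchored N γ u Z) (hN : ∀ a b, ‖N a - N b‖ ≤ ‖a - b‖)
    (hγ : 0 ≤ γ) {p : H} (hp : N p = p) {φ : ℕ → ℕ} (hφ : StrictMono φ) {q : H}
    (hq : Filter.Tendsto (u ∘ φ) Filter.atTop (nhds q)) : N q = q := by
  have h1 := (h.residual_tendsto hN hγ hp).comp hφ.tendsto_atTop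
  have h2 := hq.sub (((continuous_of_nonexpansive hN).tendsto q).comp hq)
  exact (sub_eq_zero.1 (tendsto_nhds_unique h2 h1)).symm

/-- In the difference of the energies relative to `p` and `q`, everything cancels except `‖Z k - (2γ
+ 1) p‖²` and `‖Z k - (2γ + 1) q‖²`, which leaves an affine function of `⟨Z k, p - q⟩`. -/
theorem inner_anchor_tendsto (h : IsAnchored N γ u Z)
    (hN : ∀ a b, ‖N a - N b‖ ≤ ‖a - b‖) (hγ : 0 ≤ γ) {p q : H} (hp : N p = p) (hq : N q = q) :
    ∃ l, Filter.Tendsto (fun k => ⟪Z k, p - q⟫_ℝ) Filter.atTop (nhds l) := by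
  obtain ⟨l₁, h₁⟩ := h.energy_tendsto hN hγ hp
  obtain ⟨l₂, h₂⟩ := h.energy_tendsto hN hγ hq
  have key : ∀ k, ⟪Z k, p - q⟫_ℝ = (anchoredEnergy N γ u Z q k - anchoredEnergy N γ u Z p k
      + ((2 * γ + 1) ^ 2 * ‖p‖ ^ 2 - (2 * γ + 1) ^ 2 * ‖q‖ ^ 2)) / (2 * (2 * γ + 1)) := by
    intro k
    unfold anchoredEnergy
    rw [eq_div_iff (by positivity), norm_sub_sq_real (Z k), norm_sub_sq_real (Z k), norm_smul, norm_smul,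
      mul_pow, mul_pow, Real.norm_eq_abs, sq_abs, inner_sub_right, inner_smul_right,
      inner_smul_right]
    ring
  simp only [key]
  exact ⟨_, ((h₂.sub h₁).add_const _).div_const _⟩

theorem inner_tendsto (h : IsAnchored N γ u Z)
    (hN : ∀ a b, ‖N a - N b‖ ≤ ‖a - b‖) (hγ : 0 < γ) {p q : H} (hp : N p = p) (hq : N q = q) :
    ∃ l, Filter.Tendsto (fun k => ⟪u k, p - q⟫_ℝ) Filter.atTop (nhds l) := by
  obtain ⟨l, hl⟩ := h.inner_anchor_tendsto hN hγ.le hp hq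
  set e := p - q
  have hb : Filter.Tendsto
      (fun k => (1 - (2 * γ + 1) / γ) / (2 * γ + 1) * ⟪Z (k + 1), e⟫_ℝ) Filter.atTop
      (nhds ((1 - (2 * γ + 1) / γ) / (2 * γ + 1) * l)) :=
    (hl.comp (Filter.tendsto_add_atTop_nat 1)).const_mul _
  -- Since `N (u k) = u k + (Z (k + 1) - Z k) / γ`, subtracting `Z k / γ` absorbs the increments of
  -- `Z`, which carry the large factor `k + 1`; what remains is an averaged recursion driven by `Z
  -- (k + 1)`.
  have hr : Filter.Tendsto (fun k => ⟪u k, e⟫_ℝ - ⟪Z k, e⟫_ℝ / γ) Filter.atTop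
      (nhds ((1 - (2 * γ + 1) / γ) / (2 * γ + 1) * l)) := by
    refine tendsto_of_averaged_eq (β := 2 * γ + 1) (by linarith) (fun k => ?_) hb
    have h1 := congrArg (fun w => ⟪w, e⟫_ℝ) (h.step_u k)
    have h2 := congrArg (fun w => ⟪w, e⟫_ℝ) (h.step_Z k)
    simp only [inner_smul_left, inner_add_left, inner_sub_left, conj_trivial] at h1 h2
    field_simp
    have h3 : γ * ⟪N (u k), e⟫_ℝ = γ * ⟪u k, e⟫_ℝ + ⟪Z (k + 1), e⟫_ℝ - ⟪Z k, e⟫_ℝ := by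
      linarith
    linear_combination γ * h1 + ((k : ℝ) + 1) * h3
  refine ⟨_, (hr.add (hl.div_const γ)).congr fun k => ?_⟩
  ring

theorem tendsto_of_pos [FiniteDimensional ℝ H] (h : IsAnchored N γ u Z)
    (hN : ∀ a b, ‖N a - N b‖ ≤ ‖a - b‖) (hγ : 0 < γ) (hfix : ∃ p, N p = p) :
    ∃ p, N p = p ∧ Filter.Tendsto u Filter.atTop (nhds p) := by
  obtain ⟨p₀, hp₀⟩ := hfix
  obtain ⟨C, hC⟩ := h.bounded hN hγ.le hp₀
  have hmem : ∀ k, u k ∈ Metric.closedBall p₀ C := fun k => by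
    simpa [dist_eq_norm] using hC k
  have hcpt := isCompact_closedBall p₀ C
  obtain ⟨p, -, φ, hφ, hp⟩ := hcpt.tendsto_subseq hmem
  have hpN := h.fixed_of_cluster hN hγ.le hp₀ hφ hp
  refine ⟨p, hpN, ?_⟩
  refine Filter.tendsto_of_subseq_tendsto fun ns hns => ?_
  obtain ⟨ms, hms, hns'⟩ := Filter.strictMono_subseq_of_tendsto_atTop hns
  obtain ⟨q, -, ψ, hψ, hq⟩ := hcpt.tendsto_subseq (fun n => hmem (ns (ms n)))
  have hmono : StrictMono (ns ∘ ms ∘ ψ) := hns'.comp hψ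
  have hqN := h.fixed_of_cluster hN hγ.le hp₀ hmono hq
  obtain ⟨l, hl⟩ := h.inner_tendsto hN hγ hpN hqN
  have e1 : ⟪p, p - q⟫_ℝ = l := tendsto_nhds_unique
    (hp.inner tendsto_const_nhds) (hl.comp hφ.tendsto_atTop)
  have e2 : ⟪q, p - q⟫_ℝ = l := tendsto_nhds_unique
    (hq.inner tendsto_const_nhds) (hl.comp hmono.tendsto_atTop)
  have e3 : ⟪p - q, p - q⟫_ℝ = 0 := by rw [inner_sub_left, e1, e2, sub_self]
  have e4 : p = q := sub_eq_zero.1 (inner_self_eq_zero.1 e3)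
  exact ⟨ms ∘ ψ, e4 ▸ hq⟩

theorem tendsto_of_zero [FiniteDimensional ℝ H] (h : IsAnchored N 0 u Z)
    (hN : ∀ a b, ‖N a - N b‖ ≤ ‖a - b‖) (hfix : ∃ p, N p = p) :
    ∃ p, N p = p ∧ Filter.Tendsto u Filter.atTop (nhds p) := by
  have hclosed : IsClosed {q | N q = q} :=
    isClosed_eq (continuous_of_nonexpansive hN) continuous_id
  have hZ : ∀ k, Z k = Z 0 := fun k => by
    induction k with
    | zero => rfl
    | succ k ih => rw [h.step_Z k, zero_smul, sub_zero, ih]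
  -- The limit is the projection of the constant anchor; its variational inequality at cluster
  -- points gives `hlim`.
  obtain ⟨x, hx, hmin⟩ := exists_norm_eq_iInf_of_complete_convex (K := {q | N q = q}) hfix hclosed.isComplete
    (convex_fixedPoints hN) (Z 0)
  rw [norm_eq_iInf_iff_real_inner_le_zero (convex_fixedPoints hN) hx] at hmin
  refine ⟨x, hx, ?_⟩
  have hlim : ∀ ε > 0, ∀ᶠ k in Filter.atTop, ⟪Z 0 - x, u k - x⟫_ℝ ≤ ε := by
    intro ε hε
    by_contra hcon
    obtain ⟨φ, hφ, hφε⟩ := Filter.extraction_of_frequently_atTop (Filter.not_eventually.1 hcon)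
    obtain ⟨C, hC⟩ := h.bounded hN le_rfl hx
    have hmem : ∀ k, u (φ k) ∈ Metric.closedBall x C := fun k => by
      simpa [dist_eq_norm] using hC (φ k)
    obtain ⟨q, -, ψ, hψ, hq⟩ := (isCompact_closedBall x C).tendsto_subseq hmem
    have hqN := h.fixed_of_cluster hN le_rfl hx (hφ.comp hψ) hq
    have h1 : Filter.Tendsto (fun k => ⟪Z 0 - x, u (φ (ψ k)) - x⟫_ℝ) Filter.atTop
        (nhds ⟪Z 0 - x, q - x⟫_ℝ) := tendsto_const_nhds.inner (hq.sub_const x)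
    have h2 := ge_of_tendsto' h1 (fun k => (not_le.1 (hφε (ψ k))).le)
    linarith [hmin q hqN]
  rw [tendsto_iff_norm_sub_tendsto_zero]
  have hsq : Filter.Tendsto (fun k => ‖u k - x‖ ^ 2) Filter.atTop (nhds 0) := by
    refine tendsto_zero_of_averaged_le (β := 1) le_rfl
      (e := fun k => 2 * ⟪Z 0 - x, u (k + 1) - x⟫_ℝ) (fun _ => sq_nonneg _) (fun k => ?_)
      (fun ε hε => ?_)
    · have h1 : ((k : ℝ) + 1 + 1) • (u (k + 1) - x) =
          (Z 0 - x) + ((k : ℝ) + 1) • (N (u k) - x) := by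
        have := h.step_u k
        rw [hZ, mul_zero, zero_add] at this
        rw [smul_sub, this]; module
      have h2 : ‖N (u k) - x‖ ^ 2 ≤ ‖u k - x‖ ^ 2 := by
        have := hN (u k) x
        rw [show N x = x from hx] at this
        gcongr
      have h3 : ((k : ℝ) + 1) • (N (u k) - x) =
          ((k : ℝ) + 1 + 1) • (u (k + 1) - x) - (Z 0 - x) := by rw [h1]; abel
      have h4 := congrArg (fun w => ‖w‖ ^ 2) h3
      simp only [norm_sub_sq_real (((k : ℝ) + 1 + 1) • (u (k + 1) - x)), norm_smul, mul_pow,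
        Real.norm_eq_abs, sq_abs, inner_smul_left, conj_trivial] at h4
      rw [real_inner_comm] at h4
      have hk : (0 : ℝ) < (k : ℝ) + 1 := by positivity
      have h5 := mul_le_mul_of_nonneg_left h2 (by positivity : 0 ≤ ((k : ℝ) + 1) ^ 2)
      have h6 : ((k : ℝ) + 1) ^ 2 * ‖u k - x‖ ^ 2 ≤
          ((k : ℝ) + 1 + 1) * (((k : ℝ) + 1) * ‖u k - x‖ ^ 2) := by
        nlinarith [sq_nonneg ‖u k - x‖]
      refine le_of_mul_le_mul_left (a := (k : ℝ) + 1 + 1) ?_ (by positivity)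
      nlinarith [sq_nonneg ‖Z 0 - x‖]
    · have := (Filter.tendsto_add_atTop_nat 1).eventually (hlim (ε / 2) (by positivity))
      filter_upwards [this] with k hk
      linarith
  simpa using hsq.sqrt

/-- An anchored iteration of a nonexpansive map with a fixed point converges to a fixed point. -/
theorem tendsto [FiniteDimensional ℝ H] (h : IsAnchored N γ u Z)
    (hN : ∀ a b, ‖N a - N b‖ ≤ ‖a - b‖) (hγ : 0 ≤ γ) (hfix : ∃ p, N p = p) :
    ∃ p, N p = p ∧ Filter.Tendsto u Filter.atTop (nhds p) := by
  rcases hγ.eq_or_lt with rfl | hγ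
  · exact h.tendsto_of_zero hN hfix
  · exact h.tendsto_of_pos hN hγ hfix

end IsAnchored

/-- The accelerated iteration of a nonexpansive map is an anchored iteration, and converges. -/
theorem accelerated_tendsto [FiniteDimensional ℝ H] {N : H → H}
    (hN : ∀ a b, ‖N a - N b‖ ≤ ‖a - b‖) (hfix : ∃ p, N p = p) {α : ℝ} (hα : 2 ≤ α)
    {u uhat : ℕ → H} (hhat : ∀ k, uhat (k + 1) = N (u k))
    (hu : ∀ k : ℕ, u (k + 1) = u k + (α / (2 * ((k : ℝ) + α))) • (uhat (k + 1) - u k)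
      + ((k : ℝ) / ((k : ℝ) + α)) • (uhat (k + 1) - uhat k)) :
    ∃ p, N p = p ∧ Filter.Tendsto u Filter.atTop (nhds p) := by
  have key : ∀ k : ℕ, ((k : ℝ) + α) • u (k + 1) = ((k : ℝ) + α) • u k
      + (α / 2) • (uhat (k + 1) - u k) + (k : ℝ) • (uhat (k + 1) - uhat k) := fun k => by
    have hk : (k : ℝ) + α ≠ 0 := by positivity
    rw [hu k, smul_add, smul_add, smul_smul, smul_smul]
    congr 3 <;> field_simp
  refine IsAnchored.tendsto (γ := α / 2 - 1)
    -- With `2γ + 1 = α - 1`, this is the anchor forced by `step_u`; the recursion for `u` then says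
    -- exactly how it drifts.
    (Z := fun k => (k : ℝ) • (u k - uhat k) + (α - 1) • u k) ⟨fun k => ?_, fun k => ?_⟩ hN
    (by linarith) hfix
  · rw [← hhat k]
    push_cast
    module
  · rw [← hhat k]
    have := key k
    push_cast
    linear_combination (norm := module) this

end FixedPoint

/-! ### Subgradients, minimizers and growth of convex functions -/

section ConvexAnalysis

variable {E : Type*} [NormedAddCommGroup E] [InnerProductSpace ℝ E]

theorem ProperClosedConvex.exists_real {f : E → EReal} (hf : ProperClosedConvex f) {u : E}
    (hu : f u ≠ ⊤) : ∃ a : ℝ, f u = a :=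
  ⟨(f u).toReal, (EReal.coe_toReal hu (hf.ne_bot u)).symm⟩

theorem mem_effDom_of_min {f : E → EReal} (hf : ProperClosedConvex f) {q : E → ℝ} {u : E}
    (hmin : ∀ v, f u + (q u : EReal) ≤ f v + (q v : EReal)) : u ∈ effDom f := by
  obtain ⟨v, hv⟩ := hf.exists_ne_top
  change f u < ⊤
  rw [lt_top_iff_ne_top]
  intro hu
  have h1 := hmin v
  rw [hu, EReal.top_add_coe, top_le_iff] at h1
  exact EReal.add_ne_top hv (EReal.coe_ne_top _) h1

/-- Fermat's rule for the sum of a convex function and a quadratic function. -/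
theorem neg_mem_subdiff_of_min {f : E → EReal} (hf : ProperClosedConvex f) {q : E → ℝ}
    {u G : E} (hmin : ∀ v, f u + (q u : EReal) ≤ f v + (q v : EReal))
    (hq : ∀ d, ∃ Q : ℝ, ∀ t : ℝ, q (u + t • d) = q u + t * ⟪G, d⟫_ℝ + t ^ 2 * Q) :
    -G ∈ subdiff f u := by
  have hu := mem_effDom_of_min hf hmin
  refine ⟨hu, fun v => ?_⟩
  by_cases hv : f v = ⊤
  · rw [hv]; exact le_top
  obtain ⟨a, ha⟩ := hf.exists_real hu.ne
  obtain ⟨b, hb⟩ := hf.exists_real hv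
  obtain ⟨Q, hQ⟩ := hq (v - u)
  rw [ha, hb, inner_neg_left]
  norm_cast
  have key : ∀ t : ℝ, 0 < t → t ≤ 1 → 0 ≤ b - a + ⟪G, v - u⟫_ℝ + t * Q := by
    intro t ht ht1
    have h1 := hf.convex_epigraph (x := (u, a)) (by simp [ha]) (y := (v, b)) (by simp [hb])
      (sub_nonneg.2 ht1) ht.le (sub_add_cancel 1 t)
    have h2 : (1 - t) • u + t • v = u + t • (v - u) := by module
    simp only [Prod.smul_mk, Prod.mk_add_mk, Set.mem_ofPred_eq, h2, smul_eq_mul] at h1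
    have h3 := (hmin (u + t • (v - u))).trans (add_le_add_left h1 _)
    rw [ha, hQ] at h3
    norm_cast at h3
    refine nonneg_of_mul_nonneg_right (a := t) ?_ ht
    linarith
  by_contra! hcon
  have hc : b - a + ⟪G, v - u⟫_ℝ < 0 := by linarith
  set c := b - a + ⟪G, v - u⟫_ℝ
  have hd : 0 < 2 * (|Q| + 1) := by positivity
  -- This `t` makes `t * |Q|` at most `-c / 2`, so that `c + t * Q` stays negative.
  have ht : 0 < min 1 (-c / (2 * (|Q| + 1))) := lt_min one_pos (div_pos (by linarith) hd)
  have h1 := key _ ht (min_le_left _ _)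
  have h2 := min_le_right 1 (-c / (2 * (|Q| + 1)))
  rw [le_div_iff₀ hd] at h2
  have h3 := mul_le_mul_of_nonneg_left (le_abs_self Q) ht.le
  nlinarith

/-- Outside the ball of radius `‖ψ‖ / κ` about `u` the quadratic term dominates the linear one, so
values there are no smaller than at `u`; a minimizer over the compact ball is global. -/
theorem exists_min_of_growth [FiniteDimensional ℝ E] {f : E → EReal}
    (hf : ProperClosedConvex f) {q : E → ℝ} (hq : Continuous q) {u ψ : E} {κ : ℝ}
    (hκ : 0 < κ)
    (hgr : ∀ v, f u + ((q u + ⟪ψ, v - u⟫_ℝ + κ * ‖v - u‖ ^ 2 : ℝ) : EReal) ≤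
      f v + (q v : EReal)) :
    ∃ m, ∀ v, f m + (q m : EReal) ≤ f v + (q v : EReal) := by
  have hlsc : LowerSemicontinuous fun v => f v + (q v : EReal) := by
    refine hf.lsc.add' (continuous_coe_real_ereal.comp hq).lowerSemicontinuous fun v => ?_
    exact EReal.continuousAt_add (Or.inr (EReal.coe_ne_bot _)) (Or.inr (EReal.coe_ne_top _))
  have hr : 0 ≤ ‖ψ‖ / κ := by positivity
  obtain ⟨m, -, hm⟩ := LowerSemicontinuousOn.exists_isMinOn
    (Metric.nonempty_closedBall.2 hr) (isCompact_closedBall u (‖ψ‖ / κ))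
    (hlsc.lowerSemicontinuousOn _)
  refine ⟨m, fun v => ?_⟩
  by_cases hv : v ∈ Metric.closedBall u (‖ψ‖ / κ)
  · exact hm hv
  · refine (hm (Metric.mem_closedBall_self hr)).trans (le_trans ?_ (hgr v))
    refine add_le_add_right ?_ _
    norm_cast
    rw [Metric.mem_closedBall, dist_eq_norm, not_le, div_lt_iff₀ hκ] at hv
    have h1 := neg_le_of_abs_le (abs_real_inner_le_norm ψ (v - u))
    nlinarith [norm_nonneg (v - u)]

theorem sqSeminorm_nonneg {M : E →ₗ[ℝ] E} (hM : M.IsPositive) (v : E) :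
    0 ≤ sqSeminorm M v := by
  have := hM.2 v
  rwa [RCLike.re_to_real, real_inner_comm] at this

theorem sqSeminorm_add {M : E →ₗ[ℝ] E} (hM : M.IsSymmetric) (v d : E) :
    sqSeminorm M (v + d) = sqSeminorm M v + 2 * ⟪M v, d⟫_ℝ + sqSeminorm M d := by
  unfold sqSeminorm
  rw [map_add, inner_add_left, inner_add_right, inner_add_right, ← hM v d,
    real_inner_comm d (M v)]
  ring

theorem sqSeminorm_smul (M : E →ₗ[ℝ] E) (t : ℝ) (d : E) :
    sqSeminorm M (t • d) = t ^ 2 * sqSeminorm M d := by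
  unfold sqSeminorm
  rw [map_smul, inner_smul_left, inner_smul_right, conj_trivial]
  ring

theorem continuous_sqSeminorm [FiniteDimensional ℝ E] (M : E →ₗ[ℝ] E) :
    Continuous (sqSeminorm M) :=
  continuous_id.inner M.continuous_of_finiteDimensional

/-- Every point `v` is approximated by points of smaller value which have
subgradients. -/
theorem exists_subdiff_near [FiniteDimensional ℝ E] {f : E → EReal}
    (hf : ProperClosedConvex f) {u ψ : E} (hψ : ψ ∈ subdiff f u) (v : E)
    (n : ℝ) (hn : 0 < n) :
    ∃ m, f m + ((n / 2 * ‖m - v‖ ^ 2 : ℝ) : EReal) ≤ f v ∧ (subdiff f m).Nonempty := by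
  have hexp : ∀ a b : E, n / 2 * ‖b - v‖ ^ 2 = n / 2 * ‖a - v‖ ^ 2 + n * ⟪a - v, b - a⟫_ℝ
      + n / 2 * ‖b - a‖ ^ 2 := by
    intro a b
    have : b - v = (a - v) + (b - a) := by abel
    rw [this, norm_add_sq_real]
    ring
  obtain ⟨m, hm⟩ := exists_min_of_growth hf (q := fun w => n / 2 * ‖w - v‖ ^ 2)
    (by fun_prop) (u := u) (ψ := ψ + n • (u - v)) (κ := n / 2) (by positivity) (fun w => by
      refine le_trans (le_of_eq ?_) (add_le_add_left (hψ.2 w) _)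
      rw [hexp u w, add_assoc (f u), ← EReal.coe_add]
      congr 2
      rw [inner_add_left, inner_smul_left, conj_trivial]
      ring)
  refine ⟨m, by simpa using hm v, -(n • (m - v)), neg_mem_subdiff_of_min hf (q := fun w => n / 2 * ‖w - v‖ ^ 2) hm fun d => ?_⟩
  refine ⟨n / 2 * ‖d‖ ^ 2, fun t => ?_⟩
  rw [hexp m (m + t • d), add_sub_cancel_left, inner_smul_right, inner_smul_left, norm_smul,
    mul_pow, Real.norm_eq_abs, sq_abs, conj_trivial]
  ring

/-- The growth inequality holds at every point of the domain. -/
theorem IsConvexityModulus.growth_of_mem_subdiff [FiniteDimensional ℝ E] {f : E → EReal}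
    (hf : ProperClosedConvex f) {S : E →ₗ[ℝ] E} (hS : IsConvexityModulus f S) {u ψ : E}
    (hψ : ψ ∈ subdiff f u) (v : E) :
    f u + ((⟪ψ, v - u⟫_ℝ + 1 / 2 * sqSeminorm S (v - u) : ℝ) : EReal) ≤ f v := by
  by_cases hv : f v = ⊤
  · rw [hv]; exact le_top
  obtain ⟨a, ha⟩ := hf.exists_real hψ.1.ne
  obtain ⟨b, hb⟩ := hf.exists_real hv
  -- The modulus is assumed only between points with subgradients, so `v` is replaced by its
  -- proximal points `V k`, which tend to `v`. The parameter `k + 2` leaves `k + 1` in `h4` after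
  -- Young's inequality absorbs one `‖V k - v‖²`.
  choose V hV hVs using fun k : ℕ =>
    exists_subdiff_near hf hψ v ((k : ℝ) + 2) (by positivity)
  have hVd : ∀ k, V k ∈ effDom f := fun k => (hVs k).some_mem.1
  choose e he using fun k => hf.exists_real (hVd k).ne
  have h1 : ∀ k, e k + ((k : ℝ) + 2) / 2 * ‖V k - v‖ ^ 2 ≤ b := fun k => by
    have := hV k
    rw [he, hb] at this
    exact_mod_cast this
  have h2 : ∀ k, a + ⟪ψ, V k - u⟫_ℝ ≤ e k := fun k => by
    have := hψ.2 (V k)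
    rw [he, ha] at this
    exact_mod_cast this
  have h3 : ∀ k, a + (⟪ψ, V k - u⟫_ℝ + 1 / 2 * sqSeminorm S (V k - u)) ≤ e k := fun k => by
    have := hS.growth _ (hVd k) _ hψ.1 _ (hVs k).some_mem _ hψ
    rw [he, ha] at this
    exact_mod_cast this
  set C := 2 * (b - a - ⟪ψ, v - u⟫_ℝ) + ‖ψ‖ ^ 2
  have h4 : ∀ k : ℕ, ‖V k - v‖ ^ 2 ≤ C / ((k : ℝ) + 1) := fun k => by
    rw [le_div_iff₀ (by positivity)]
    have e1 : ⟪ψ, V k - u⟫_ℝ = ⟪ψ, v - u⟫_ℝ + ⟪ψ, V k - v⟫_ℝ := by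
      rw [← inner_add_right]; congr 1; abel
    have e2 := neg_le_of_abs_le (abs_real_inner_le_norm ψ (V k - v))
    nlinarith [h1 k, h2 k, sq_nonneg (‖ψ‖ - ‖V k - v‖)]
  have h5 : Filter.Tendsto (fun k => ‖V k - v‖ ^ 2) Filter.atTop (nhds 0) :=
    squeeze_zero (fun _ => sq_nonneg _) h4 (Filter.Tendsto.div_atTop tendsto_const_nhds
      (Filter.tendsto_atTop_add_const_right _ _ tendsto_natCast_atTop_atTop))
  have h6 : Filter.Tendsto V Filter.atTop (nhds v) := by
    rw [tendsto_iff_norm_sub_tendsto_zero]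
    simpa using h5.sqrt
  have h7 : Filter.Tendsto
      (fun k => a + (⟪ψ, V k - u⟫_ℝ + 1 / 2 * sqSeminorm S (V k - u))) Filter.atTop
      (nhds (a + (⟪ψ, v - u⟫_ℝ + 1 / 2 * sqSeminorm S (v - u)))) :=
    ((tendsto_const_nhds.inner (h6.sub_const u)).add
      ((((continuous_sqSeminorm S).tendsto _).comp (h6.sub_const u)).const_mul _)).const_add _
  rw [ha, hb]
  norm_cast
  refine le_of_tendsto' h7 fun k => (h3 k).trans (le_trans ?_ (h1 k))
  have : 0 ≤ ((k : ℝ) + 2) / 2 * ‖V k - v‖ ^ 2 := by positivity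
  linarith

end ConvexAnalysis

/-! ### Solvability and stability of the regularized subproblems -/

section Subproblem

variable {E X : Type*}
  [NormedAddCommGroup E] [InnerProductSpace ℝ E] [FiniteDimensional ℝ E]
  [NormedAddCommGroup X] [InnerProductSpace ℝ X] [FiniteDimensional ℝ X]

/-- The form is positive off zero, whatever the weight `σ > 0`; its minimum on the unit sphere and
homogeneity of degree two give the constant. -/
theorem PosDef.exists_coercive {S T : E →ₗ[ℝ] E} {B : E →ₗ[ℝ] X} (hS : S.IsPositive)
    (hT : T.IsPositive) (h : PosDef (S + LinearMap.adjoint B ∘ₗ B + T)) {σ : ℝ} (hσ : 0 < σ) :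
    ∃ κ > 0, ∀ d, κ * ‖d‖ ^ 2 ≤ sqSeminorm S d + σ * ‖B d‖ ^ 2 + sqSeminorm T d := by
  set h' : E → ℝ := fun d => sqSeminorm S d + σ * ‖B d‖ ^ 2 + sqSeminorm T d with h'_def
  have hcont : Continuous h' := by
    have hB : Continuous B := B.continuous_of_finiteDimensional
    exact ((continuous_sqSeminorm S).add (continuous_const.mul (hB.norm.pow 2))).add
      (continuous_sqSeminorm T)
  have hpos : ∀ d, d ≠ 0 → 0 < h' d := by
    intro d hd
    have h1 := h.2 d hd
    simp only [LinearMap.add_apply, LinearMap.comp_apply, inner_add_right,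
      LinearMap.adjoint_inner_right, real_inner_self_eq_norm_sq] at h1
    have h2 := sqSeminorm_nonneg hS d
    have h3 := sqSeminorm_nonneg hT d
    have h4 : 0 ≤ σ * ‖B d‖ ^ 2 := by positivity
    by_contra! hcon
    simp only [h'_def] at hcon
    have h5 : σ * ‖B d‖ ^ 2 = 0 := by linarith
    have h6 : ‖B d‖ ^ 2 = 0 := (mul_eq_zero.1 h5).resolve_left hσ.ne'
    unfold sqSeminorm at *
    linarith
  rcases (Metric.sphere (0 : E) 1).eq_empty_or_nonempty with hemp | hne
  · refine ⟨1, one_pos, fun d => ?_⟩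
    have hd : d = 0 := by
      by_contra hd
      have : ‖d‖⁻¹ • d ∈ Metric.sphere (0 : E) 1 := by
        simp [norm_smul, hd]
      rw [hemp] at this
      exact this
    subst hd
    simp [sqSeminorm]
  · obtain ⟨m, hm, hmin⟩ := (isCompact_sphere (0 : E) 1).exists_isMinOn hne hcont.continuousOn
    have hm0 : m ≠ 0 := by
      rintro rfl
      simp at hm
    refine ⟨h' m, hpos m hm0, fun d => ?_⟩
    by_cases hd : d = 0
    · subst hd
      simp [sqSeminorm]
    have hd' : ‖d‖ ≠ 0 := norm_ne_zero_iff.2 hd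
    have h1 : h' m ≤ h' (‖d‖⁻¹ • d) := hmin (by simp [norm_smul, hd])
    have h2 : h' (‖d‖⁻¹ • d) = ‖d‖⁻¹ ^ 2 * h' d := by
      simp only [h'_def, sqSeminorm_smul, map_smul, norm_smul, mul_pow, Real.norm_eq_abs, sq_abs]
      ring
    rw [h2] at h1
    calc h' m * ‖d‖ ^ 2 ≤ ‖d‖⁻¹ ^ 2 * h' d * ‖d‖ ^ 2 := by gcongr
      _ = h' d := by field_simp

/-- The smooth part `⟨x, B v + b⟩ + (σ/2) ‖B v + b‖² + ½ ‖v - e‖²_T` of a subproblem. -/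
noncomputable def smoothPart (B : E →ₗ[ℝ] X) (T : E →ₗ[ℝ] E) (σ : ℝ) (x b : X) (e v : E) : ℝ :=
  ⟪x, B v + b⟫_ℝ + σ / 2 * ‖B v + b‖ ^ 2 + 1 / 2 * sqSeminorm T (v - e)

/-- The gradient of `smoothPart`. -/
noncomputable def smoothGrad (B : E →ₗ[ℝ] X) (T : E →ₗ[ℝ] E) (σ : ℝ) (x b : X) (e v : E) : E :=
  LinearMap.adjoint B (x + σ • (B v + b)) + T (v - e)

theorem smoothPart_add (B : E →ₗ[ℝ] X) {T : E →ₗ[ℝ] E} (hT : T.IsPositive) (σ : ℝ) (x b : X)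
    (e v d : E) :
    smoothPart B T σ x b e (v + d) = smoothPart B T σ x b e v
      + ⟪smoothGrad B T σ x b e v, d⟫_ℝ + (σ / 2 * ‖B d‖ ^ 2 + 1 / 2 * sqSeminorm T d) := by
  unfold smoothPart smoothGrad
  have h1 : B (v + d) + b = (B v + b) + B d := by rw [map_add]; abel
  have h2 : v + d - e = (v - e) + d := by abel
  rw [h1, h2, sqSeminorm_add hT.1, norm_add_sq_real, inner_add_left (_ : E), inner_add_right,
    LinearMap.adjoint_inner_left, inner_add_left x, inner_smul_left, conj_trivial]
  ring

theorem neg_smoothGrad_mem_subdiff {f : E → EReal} (hf : ProperClosedConvex f)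
    (B : E →ₗ[ℝ] X) {T : E →ₗ[ℝ] E} (hT : T.IsPositive) (σ : ℝ) (x b : X) (e : E) {m : E}
    (hm : ∀ v, f m + (smoothPart B T σ x b e m : EReal) ≤
      f v + (smoothPart B T σ x b e v : EReal)) :
    -smoothGrad B T σ x b e m ∈ subdiff f m := by
  refine neg_mem_subdiff_of_min hf hm fun d =>
    ⟨σ / 2 * ‖B d‖ ^ 2 + 1 / 2 * sqSeminorm T d, fun t => ?_⟩
  rw [smoothPart_add B hT, inner_smul_right, sqSeminorm_smul, map_smul, norm_smul, mul_pow,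
    Real.norm_eq_abs, sq_abs]
  ring

theorem exists_subproblem_min {f : E → EReal} (hf : ProperClosedConvex f)
    {S T : E →ₗ[ℝ] E} (hS : IsConvexityModulus f S) (hT : T.IsPositive) {B : E →ₗ[ℝ] X}
    (hPD : PosDef (S + LinearMap.adjoint B ∘ₗ B + T)) {σ : ℝ} (hσ : 0 < σ)
    {u ψ : E} (hψ : ψ ∈ subdiff f u) (x b : X) (e : E) :
    ∃ m, ∀ v, f m + (smoothPart B T σ x b e m : EReal) ≤
      f v + (smoothPart B T σ x b e v : EReal) := by
  obtain ⟨κ, hκ, hco⟩ := hPD.exists_coercive hS.isPositive hT hσ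
  have hcont : Continuous (smoothPart B T σ x b e) := by
    have hB : Continuous B := B.continuous_of_finiteDimensional
    have hT := continuous_sqSeminorm T
    unfold smoothPart
    fun_prop
  refine exists_min_of_growth hf hcont (u := u) (ψ := ψ + smoothGrad B T σ x b e u)
    (κ := κ / 2) (by positivity) fun v => ?_
  refine le_trans ?_ (add_le_add_left (hS.growth_of_mem_subdiff hf hψ v) _)
  rw [add_assoc (f u), ← EReal.coe_add]
  refine add_le_add_right (EReal.coe_le_coe_iff.2 ?_) _
  have h1 := smoothPart_add B hT σ x b e u (v - u)
  rw [add_sub_cancel] at h1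
  rw [h1, inner_add_left]
  linarith [hco (v - u)]

/-- The solution of a subproblem depends in a Lipschitz way on its data. -/
theorem exists_subproblem_lipschitz {f : E → EReal}
    {S T : E →ₗ[ℝ] E} (hS : IsConvexityModulus f S) (hT : T.IsPositive) {B : E →ₗ[ℝ] X}
    (hPD : PosDef (S + LinearMap.adjoint B ∘ₗ B + T)) {σ : ℝ} (hσ : 0 < σ) :
    ∃ C ≥ 0, ∀ (x x' b b' : X) (e e' m m' : E), -smoothGrad B T σ x b e m ∈ subdiff f m →
      -smoothGrad B T σ x' b' e' m' ∈ subdiff f m' →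
      ‖m - m'‖ ≤ C * (‖(x + σ • b) - (x' + σ • b')‖ + ‖T (e - e')‖) := by
  obtain ⟨κ, hκ, hco⟩ := hPD.exists_coercive hS.isPositive hT hσ
  set B' := LinearMap.toContinuousLinearMap B
  refine ⟨(‖B'‖ + 1) / κ, by positivity, fun x x' b b' e e' m m' hm hm' => ?_⟩
  have h1 := hS.monotone _ hm.1 _ hm'.1 _ hm _ hm'
  have h2 := hco (m - m')
  set p := (x + σ • b) - (x' + σ • b') with hp
  -- The data enter the difference of gradients only through `x + σ • b` and `T e`. This is why a
  -- step depends on `w` only through `R w`.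
  have h3 : -smoothGrad B T σ x b e m - -smoothGrad B T σ x' b' e' m' =
      -(LinearMap.adjoint B (p + σ • B (m - m'))) - T (m - m') + T (e - e') := by
    unfold smoothGrad
    rw [hp]
    simp only [map_add, map_sub, map_smul]
    module
  rw [h3, inner_add_left, inner_sub_left, inner_neg_left, LinearMap.adjoint_inner_left,
    inner_add_left, inner_smul_left, conj_trivial, real_inner_self_eq_norm_sq,
    real_inner_comm _ (T (m - m'))] at h1
  unfold sqSeminorm at h1 h2
  have h4 := neg_le_of_abs_le (abs_real_inner_le_norm p (B (m - m')))
  have h5 := real_inner_le_norm (T (e - e')) (m - m')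
  have h6 : ‖B (m - m')‖ ≤ ‖B'‖ * ‖m - m'‖ := B'.le_opNorm _
  have h7 := mul_le_mul_of_nonneg_left h6 (norm_nonneg p)
  rw [div_mul_eq_mul_div, le_div_iff₀ hκ]
  rcases (norm_nonneg (m - m')).eq_or_lt with h0 | h0
  · rw [← h0, zero_mul]
    positivity
  refine le_of_mul_le_mul_right ?_ h0
  have h8 := mul_nonneg (mul_nonneg (norm_nonneg B') (norm_nonneg (T (e - e')))) h0.le
  have h9 := mul_nonneg (norm_nonneg p) h0.le
  nlinarith

end Subproblem

/-! ### Square-root factors, relaxation and conjugates -/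

theorem exists_factor {E : Type*} [NormedAddCommGroup E] [InnerProductSpace ℝ E]
    [FiniteDimensional ℝ E] {T : E →ₗ[ℝ] E} (hT : T.IsPositive) :
    ∃ (n : ℕ) (R : E →ₗ[ℝ] EuclideanSpace ℝ (Fin n)), ∀ a b, ⟪R a, R b⟫_ℝ = ⟪a, T b⟫_ℝ := by
  set e := hT.isSymmetric.eigenvectorBasis (n := Module.finrank ℝ E) rfl with he
  set l := hT.isSymmetric.eigenvalues (n := Module.finrank ℝ E) rfl with hl
  have hl0 : ∀ i, 0 ≤ l i := fun i => hT.nonneg_eigenvalues rfl i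
  refine ⟨Module.finrank ℝ E,
    -- These are the coordinates of the square root of `T` in an orthonormal eigenbasis.
    { toFun := fun v => WithLp.toLp 2 fun i => Real.sqrt (l i) * ⟪e i, v⟫_ℝ
      map_add' := fun a b => by ext i; simp [inner_add_right, mul_add]
      map_smul' := fun t a => by ext i; simp [inner_smul_right]; ring }, fun a b => ?_⟩
  rw [← e.sum_inner_mul_inner a (T b)]
  simp only [LinearMap.coe_mk, AddHom.coe_mk, PiLp.inner_apply]
  refine Finset.sum_congr rfl fun i _ => ?_
  have h1 : ⟪e i, T b⟫_ℝ = l i * ⟪e i, b⟫_ℝ := by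
    rw [← hT.isSymmetric (e i) b, he, hT.isSymmetric.apply_eigenvectorBasis, inner_smul_left]
    simp [hl]
  have h2 := Real.mul_self_sqrt (hl0 i)
  rw [h1, real_inner_comm (e i) a]
  simp only [RCLike.inner_apply, conj_trivial]
  linear_combination (⟪e i, a⟫_ℝ * ⟪e i, b⟫_ℝ) * h2

theorem exists_norm_le_sqrt_sqSeminorm {E : Type*} [NormedAddCommGroup E]
    [InnerProductSpace ℝ E] [FiniteDimensional ℝ E] {T : E →ₗ[ℝ] E} (hT : T.IsPositive) :
    ∃ C ≥ 0, ∀ d, ‖T d‖ ≤ C * Real.sqrt (sqSeminorm T d) := by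
  obtain ⟨n, R, hR⟩ := exists_factor hT
  set R' := LinearMap.toContinuousLinearMap R
  refine ⟨‖R'‖, norm_nonneg _, fun d => ?_⟩
  have h1 : Real.sqrt (sqSeminorm T d) = ‖R d‖ := by
    rw [sqSeminorm, ← hR, real_inner_self_eq_norm_sq, Real.sqrt_sq (norm_nonneg _)]
  have h2 : ‖T d‖ ^ 2 = ⟪R (T d), R d⟫_ℝ := by rw [hR, real_inner_self_eq_norm_sq]
  have h3 := real_inner_le_norm (R (T d)) (R d)
  have h4 : ‖R (T d)‖ ≤ ‖R'‖ * ‖T d‖ := R'.le_opNorm _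
  have h5 := mul_le_mul_of_nonneg_right h4 (norm_nonneg (R d))
  rw [h1]
  rcases (norm_nonneg (T d)).eq_or_lt with h0 | h0
  · rw [← h0]
    positivity
  · refine le_of_mul_le_mul_right ?_ h0
    nlinarith

/-- Relaxing a firmly nonexpansive map by a factor in `[0, 2]` keeps it nonexpansive. -/
theorem norm_relax_le {H : Type*} [NormedAddCommGroup H] [InnerProductSpace ℝ H] {a b : H}
    (h : 0 ≤ ⟪b, a - b⟫_ℝ) {ρ : ℝ} (hρ : 0 ≤ ρ) (hρ' : ρ ≤ 2) :
    ‖(1 - ρ) • a + ρ • b‖ ≤ ‖a‖ := by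
  have h1 : (1 - ρ) • a + ρ • b = a - ρ • (a - b) := by module
  have h2 : ⟪a, a - b⟫_ℝ = ‖a - b‖ ^ 2 + ⟪b, a - b⟫_ℝ := by
    rw [← real_inner_self_eq_norm_sq, ← inner_add_left, sub_add_cancel]
  refine le_of_abs_le (abs_le_of_sq_le_sq ?_ (norm_nonneg _))
  rw [h1, norm_sub_sq_real, inner_smul_right, h2, norm_smul, mul_pow, Real.norm_eq_abs, sq_abs]
  have h3 := mul_nonneg hρ h
  have h4 := mul_nonneg (mul_nonneg hρ (sub_nonneg.2 hρ')) (sq_nonneg ‖a - b‖)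
  linarith

theorem sub_le_conjugate {E : Type*} [NormedAddCommGroup E] [InnerProductSpace ℝ E]
    (f : E → EReal) {u : E} {a : ℝ} (ha : f u = a) (φ : E) :
    ((⟪φ, u⟫_ℝ - a : ℝ) : EReal) ≤ conjugate f φ := by
  have := le_iSup (fun u => (((⟪φ, u⟫_ℝ : ℝ) : EReal) - f u)) u
  rwa [ha, ← EReal.coe_sub] at this

/-- The equality case of Fenchel–Young. -/
theorem conjugate_eq_of_mem_subdiff {E : Type*} [NormedAddCommGroup E] [InnerProductSpace ℝ E]
    {f : E → EReal} {u φ : E} {a : ℝ} (ha : f u = a) (h : φ ∈ subdiff f u) :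
    conjugate f φ = ((⟪φ, u⟫_ℝ - a : ℝ) : EReal) := by
  refine le_antisymm (iSup_le fun v => ?_) (sub_le_conjugate f ha φ)
  refine EReal.sub_le_of_le_add' ?_
  refine le_trans (le_of_eq ?_) (add_le_add_left (h.2 v) _)
  rw [ha]
  norm_cast
  rw [inner_sub_right]
  ring

/-! ### KKT points, duality and one pADMM step -/

namespace Problem

variable {Y Z X : Type*}
  [NormedAddCommGroup Y] [InnerProductSpace ℝ Y] [FiniteDimensional ℝ Y]
  [NormedAddCommGroup Z] [InnerProductSpace ℝ Z] [FiniteDimensional ℝ Z]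
  [NormedAddCommGroup X] [InnerProductSpace ℝ X] [FiniteDimensional ℝ X]

theorem IsKKT.le {P : Problem Y Z X} {y : Y} {z : Z} {x : X} (h : P.IsKKT y z x) (y' : Y)
    (z' : Z) :
    P.f₁ y + P.f₂ z + ((-⟪x, P.B₁ y' + P.B₂ z' - P.c⟫_ℝ : ℝ) : EReal) ≤
      P.f₁ y' + P.f₂ z' := by
  refine le_trans (le_of_eq ?_) (add_le_add (h.1.2 y') (h.2.1.2 z'))
  rw [add_add_add_comm, ← EReal.coe_add]
  congr 2
  have hc : P.c = P.B₁ y + P.B₂ z := (sub_eq_zero.1 h.2.2).symm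
  rw [hc, inner_neg_left, inner_neg_left, LinearMap.adjoint_inner_left,
    LinearMap.adjoint_inner_left]
  simp only [map_sub, inner_sub_right, inner_add_right]
  ring

theorem IsKKT.isPrimalSolution {P : Problem Y Z X} {y : Y} {z : Z} {x : X}
    (h : P.IsKKT y z x) : P.IsPrimalSolution y z := by
  refine ⟨⟨h.1.1, h.2.1.1, sub_eq_zero.1 h.2.2⟩, fun y' z' hc => ?_⟩
  simpa [hc] using h.le y' z'

theorem IsKKT.isDualSolution {P : Problem Y Z X} (hf₁ : ProperClosedConvex P.f₁)
    (hf₂ : ProperClosedConvex P.f₂) {y : Y} {z : Z} {x : X}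
    (h : P.IsKKT y z x) : P.IsDualSolution x := by
  obtain ⟨a, ha⟩ := hf₁.exists_real h.1.1.ne
  obtain ⟨b, hb⟩ := hf₂.exists_real h.2.1.1.ne
  have hc : P.c = P.B₁ y + P.B₂ z := (sub_eq_zero.1 h.2.2).symm
  -- By feasibility, the dual objective with both conjugates replaced by their Fenchel–Young lower
  -- bounds at `y` and `z` does not depend on `x'`. At `x` the bounds are equalities.
  have key : ∀ x' : X, ((a + b : ℝ) : EReal) =
      -((⟪-(LinearMap.adjoint P.B₁ x'), y⟫_ℝ - a : ℝ) : EReal)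
        - ((⟪-(LinearMap.adjoint P.B₂ x'), z⟫_ℝ - b : ℝ) : EReal)
        - ((⟪P.c, x'⟫_ℝ : ℝ) : EReal) := by
    intro x'
    norm_cast
    rw [hc, inner_neg_left, inner_neg_left, LinearMap.adjoint_inner_left,
      LinearMap.adjoint_inner_left, inner_add_left, real_inner_comm x', real_inner_comm x']
    ring
  have hx : P.dualObjective x = ((a + b : ℝ) : EReal) := by
    rw [key x, dualObjective, conjugate_eq_of_mem_subdiff ha h.1,
      conjugate_eq_of_mem_subdiff hb h.2.1]
  refine ⟨hx ▸ EReal.bot_lt_coe _, fun x' => ?_⟩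
  rw [hx, key x', dualObjective]
  exact EReal.sub_le_sub (EReal.sub_le_sub (EReal.neg_le_neg_iff.2 (sub_le_conjugate _ ha _))
    (sub_le_conjugate _ hb _)) le_rfl

/-- The optimality conditions that characterize one step `w ↦ wbar` of the pADMM. -/
structure IsStep (P : Problem Y Z X) (T₁ : Y →ₗ[ℝ] Y) (T₂ : Z →ₗ[ℝ] Z) (σ : ℝ)
    (w wbar : Y × Z × X) : Prop where
  z : -smoothGrad P.B₂ T₂ σ w.2.2 (P.B₁ w.1 - P.c) w.2.1 wbar.2.1 ∈ subdiff P.f₂ wbar.2.1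
  x : wbar.2.2 = w.2.2 + σ • (P.B₁ w.1 + P.B₂ wbar.2.1 - P.c)
  y : -smoothGrad P.B₁ T₁ σ wbar.2.2 (P.B₂ wbar.2.1 - P.c) w.1 wbar.1 ∈ subdiff P.f₁ wbar.1

variable {P : Problem Y Z X} {T₁ : Y →ₗ[ℝ] Y} {T₂ : Z →ₗ[ℝ] Z} {σ : ℝ}

theorem zObjective_eq (y : Y) (z₀ : Z) (x : X) (z : Z) :
    P.zObjective T₂ σ y z₀ x z =
      P.f₂ z + (smoothPart P.B₂ T₂ σ x (P.B₁ y - P.c) z₀ z : EReal) := by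
  have : P.B₁ y + P.B₂ z - P.c = P.B₂ z + (P.B₁ y - P.c) := by abel
  rw [zObjective, coupling, smoothPart, this]

theorem yObjective_eq (y₀ : Y) (z : Z) (x : X) (y : Y) :
    P.yObjective T₁ σ y₀ z x y =
      P.f₁ y + (smoothPart P.B₁ T₁ σ x (P.B₂ z - P.c) y₀ y : EReal) := by
  rw [yObjective, coupling, smoothPart, add_sub_assoc]

theorem isStep_of_min (hf₁ : ProperClosedConvex P.f₁) (hf₂ : ProperClosedConvex P.f₂)
    (hT₁ : T₁.IsPositive) (hT₂ : T₂.IsPositive) {w wbar : Y × Z × X}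
    (hz : ∀ z, P.zObjective T₂ σ w.1 w.2.1 w.2.2 wbar.2.1 ≤
      P.zObjective T₂ σ w.1 w.2.1 w.2.2 z)
    (hx : wbar.2.2 = w.2.2 + σ • (P.B₁ w.1 + P.B₂ wbar.2.1 - P.c))
    (hy : ∀ y, P.yObjective T₁ σ w.1 wbar.2.1 wbar.2.2 wbar.1 ≤
      P.yObjective T₁ σ w.1 wbar.2.1 wbar.2.2 y) : P.IsStep T₁ T₂ σ w wbar := by
  simp only [zObjective_eq] at hz
  simp only [yObjective_eq] at hy
  exact ⟨neg_smoothGrad_mem_subdiff hf₂ _ hT₂ _ _ _ _ hz, hx,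
    neg_smoothGrad_mem_subdiff hf₁ _ hT₁ _ _ _ _ hy⟩

theorem IsStep.smoothGrad_z {w wbar : Y × Z × X} (h : P.IsStep T₁ T₂ σ w wbar) :
    smoothGrad P.B₂ T₂ σ w.2.2 (P.B₁ w.1 - P.c) w.2.1 wbar.2.1 =
      LinearMap.adjoint P.B₂ wbar.2.2 + T₂ (wbar.2.1 - w.2.1) := by
  have : P.B₁ w.1 + P.B₂ wbar.2.1 - P.c = P.B₂ wbar.2.1 + (P.B₁ w.1 - P.c) := by abel
  rw [smoothGrad, h.x, this]

theorem IsKKT.isStep {w : Y × Z × X} (h : P.IsKKT w.1 w.2.1 w.2.2) :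
    P.IsStep T₁ T₂ σ w w := by
  have h3 := h.2.2
  have h4 : P.B₂ w.2.1 + (P.B₁ w.1 - P.c) = 0 := by rw [← h3]; abel
  refine ⟨?_, by rw [h3, smul_zero, add_zero], ?_⟩
  · simpa [smoothGrad, h4] using h.2.1
  · simpa [smoothGrad, ← add_sub_assoc, h3] using h.1

/-- `R` factors the degenerate proximal operator of the pADMM, scaled by `σ`. -/
def IsFactor {H : Type*} [NormedAddCommGroup H] [InnerProductSpace ℝ H] (P : Problem Y Z X)
    (T₁ : Y →ₗ[ℝ] Y) (T₂ : Z →ₗ[ℝ] Z) (σ : ℝ) (R : (Y × Z × X) →ₗ[ℝ] H) : Prop :=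
  ∀ w w', ⟪R w, R w'⟫_ℝ = σ * ⟪w.1, T₁ w'.1⟫_ℝ + σ * ⟪w.2.1, T₂ w'.2.1⟫_ℝ
    + ⟪σ • P.B₁ w.1 + w.2.2, σ • P.B₁ w'.1 + w'.2.2⟫_ℝ

theorem exists_isFactor (P : Problem Y Z X) (hT₁ : T₁.IsPositive) (hT₂ : T₂.IsPositive)
    (hσ : 0 < σ) :
    ∃ (n m : ℕ) (R : (Y × Z × X) →ₗ[ℝ]
      WithLp 2 (EuclideanSpace ℝ (Fin n) × WithLp 2 (EuclideanSpace ℝ (Fin m) × X))),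
      P.IsFactor T₁ T₂ σ R := by
  obtain ⟨n, R₁, hR₁⟩ := exists_factor hT₁
  obtain ⟨m, R₂, hR₂⟩ := exists_factor hT₂
  have hs := Real.mul_self_sqrt hσ.le
  refine ⟨n, m, (WithLp.linearEquiv 2 ℝ _).symm.toLinearMap ∘ₗ
    ((Real.sqrt σ • R₁) ∘ₗ LinearMap.fst ℝ Y (Z × X)).prod
      ((WithLp.linearEquiv 2 ℝ _).symm.toLinearMap ∘ₗ
        (((Real.sqrt σ • R₂) ∘ₗ LinearMap.fst ℝ Z X ∘ₗ LinearMap.snd ℝ Y (Z × X)).prod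
          ((σ • P.B₁) ∘ₗ LinearMap.fst ℝ Y (Z × X)
            + LinearMap.snd ℝ Z X ∘ₗ LinearMap.snd ℝ Y (Z × X)))), fun w w' => ?_⟩
  rw [← hR₁, ← hR₂]
  simp [WithLp.prod_inner_apply, inner_smul_left, inner_smul_right]
  rw [← mul_assoc, ← mul_assoc, hs, add_assoc]

/-! ### The step in the degenerate metric -/

section Factor

variable {H : Type*} [NormedAddCommGroup H] [InnerProductSpace ℝ H]
  {R : (Y × Z × X) →ₗ[ℝ] H}

theorem IsFactor.norm_sq (hR : P.IsFactor T₁ T₂ σ R) (w : Y × Z × X) :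
    ‖R w‖ ^ 2 = σ * sqSeminorm T₁ w.1 + σ * sqSeminorm T₂ w.2.1
      + ‖σ • P.B₁ w.1 + w.2.2‖ ^ 2 := by
  rw [← real_inner_self_eq_norm_sq, hR, real_inner_self_eq_norm_sq, sqSeminorm, sqSeminorm]

/-- The data on which a step depends are controlled by the factor. -/
theorem IsFactor.exists_norm_le (hT₁ : T₁.IsPositive) (hT₂ : T₂.IsPositive)
    (hσ : 0 < σ) (hR : P.IsFactor T₁ T₂ σ R) :
    ∃ C ≥ 0, ∀ w, ‖T₁ w.1‖ ≤ C * ‖R w‖ ∧ ‖T₂ w.2.1‖ ≤ C * ‖R w‖ ∧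
      ‖σ • P.B₁ w.1 + w.2.2‖ ≤ ‖R w‖ := by
  obtain ⟨C₁, hC₁, h₁⟩ := exists_norm_le_sqrt_sqSeminorm hT₁
  obtain ⟨C₂, hC₂, h₂⟩ := exists_norm_le_sqrt_sqSeminorm hT₂
  have hs : 0 < Real.sqrt σ := Real.sqrt_pos.2 hσ
  refine ⟨(C₁ + C₂) / Real.sqrt σ, by positivity, fun w => ?_⟩
  have h := hR.norm_sq w
  have e1 := mul_nonneg hσ.le (sqSeminorm_nonneg hT₁ w.1)
  have e2 := mul_nonneg hσ.le (sqSeminorm_nonneg hT₂ w.2.1)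
  have e3 := sq_nonneg ‖σ • P.B₁ w.1 + w.2.2‖
  have g1 : Real.sqrt (sqSeminorm T₁ w.1) ≤ ‖R w‖ / Real.sqrt σ := by
    rw [le_div_iff₀ hs, mul_comm, ← Real.sqrt_mul hσ.le]
    exact Real.sqrt_le_iff.2 ⟨norm_nonneg _, by linarith⟩
  have g2 : Real.sqrt (sqSeminorm T₂ w.2.1) ≤ ‖R w‖ / Real.sqrt σ := by
    rw [le_div_iff₀ hs, mul_comm, ← Real.sqrt_mul hσ.le]
    exact Real.sqrt_le_iff.2 ⟨norm_nonneg _, by linarith⟩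
  have hn : 0 ≤ ‖R w‖ / Real.sqrt σ := by positivity
  refine ⟨?_, ?_, ?_⟩
  · rw [div_mul_eq_mul_div, mul_div_assoc]
    nlinarith [h₁ w.1, mul_le_mul_of_nonneg_left g1 hC₁, mul_nonneg hC₂ hn]
  · rw [div_mul_eq_mul_div, mul_div_assoc]
    nlinarith [h₂ w.2.1, mul_le_mul_of_nonneg_left g2 hC₂, mul_nonneg hC₁ hn]
  · exact le_of_abs_le (abs_le_of_sq_le_sq (by linarith) (norm_nonneg _))

/-- A step depends in a Lipschitz way on the factored data. -/
theorem IsFactor.exists_lipschitz {S₁ : Y →ₗ[ℝ] Y} {S₂ : Z →ₗ[ℝ] Z}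
    (hS₁ : IsConvexityModulus P.f₁ S₁) (hS₂ : IsConvexityModulus P.f₂ S₂)
    (hT₁ : T₁.IsPositive) (hT₂ : T₂.IsPositive) (hσ : 0 < σ)
    (hPD₁ : PosDef (S₁ + LinearMap.adjoint P.B₁ ∘ₗ P.B₁ + T₁))
    (hPD₂ : PosDef (S₂ + LinearMap.adjoint P.B₂ ∘ₗ P.B₂ + T₂))
    (hR : P.IsFactor T₁ T₂ σ R) :
    ∃ C, ∀ w w' v v', P.IsStep T₁ T₂ σ w v → P.IsStep T₁ T₂ σ w' v' →
      ‖v - v'‖ ≤ C * ‖R w - R w'‖ := by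
  obtain ⟨C₁, hC₁, h₁⟩ := exists_subproblem_lipschitz hS₁ hT₁ hPD₁ hσ
  obtain ⟨C₂, hC₂, h₂⟩ := exists_subproblem_lipschitz hS₂ hT₂ hPD₂ hσ
  obtain ⟨C, hC, hT⟩ := hR.exists_norm_le hT₁ hT₂ hσ
  set K := ‖LinearMap.toContinuousLinearMap P.B₂‖
  set A := C₂ * (1 + C) with hA
  have hA0 : 0 ≤ A := by positivity
  have hK : 0 ≤ K := norm_nonneg _
  refine ⟨A + (1 + σ * K * A) + C₁ * (1 + 2 * (σ * K * A) + C), fun w w' v v' h h' => ?_⟩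
  obtain ⟨t1, t2, t3⟩ := hT (w - w')
  rw [map_sub] at t1 t2 t3
  set r := ‖R w - R w'‖
  have hr : 0 ≤ r := norm_nonneg _
  have ez : ‖v.2.1 - v'.2.1‖ ≤ A * r := by
    refine (h₂ _ _ _ _ _ _ _ _ h.z h'.z).trans ?_
    have e : w.2.2 + σ • (P.B₁ w.1 - P.c) - (w'.2.2 + σ • (P.B₁ w'.1 - P.c)) =
        σ • P.B₁ (w - w').1 + (w - w').2.2 := by
      simp only [Prod.fst_sub, Prod.snd_sub, map_sub]; module
    rw [e, hA, mul_assoc]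
    refine mul_le_mul_of_nonneg_left ?_ hC₂
    rw [← Prod.fst_sub w.2, ← Prod.snd_sub w]
    linarith
  have eB : ‖σ • P.B₂ (v.2.1 - v'.2.1)‖ ≤ σ * K * A * r := by
    rw [norm_smul, Real.norm_of_nonneg hσ.le]
    have := (LinearMap.toContinuousLinearMap P.B₂).le_opNorm (v.2.1 - v'.2.1)
    have h3 := mul_le_mul_of_nonneg_left ez hK
    have h4 := mul_le_mul_of_nonneg_left (this.trans h3) hσ.le
    calc _ ≤ _ := h4
      _ = _ := by ring
  have ex : v.2.2 - v'.2.2 =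
      (σ • P.B₁ (w - w').1 + (w - w').2.2) + σ • P.B₂ (v.2.1 - v'.2.1) := by
    rw [h.x, h'.x]
    simp only [Prod.fst_sub, Prod.snd_sub, map_sub]; module
  have ex' : ‖v.2.2 - v'.2.2‖ ≤ (1 + σ * K * A) * r := by
    rw [ex]
    refine (norm_add_le _ _).trans ?_
    linarith
  have ey : ‖v.1 - v'.1‖ ≤ C₁ * (1 + 2 * (σ * K * A) + C) * r := by
    refine (h₁ _ _ _ _ _ _ _ _ h.y h'.y).trans ?_
    have e : v.2.2 + σ • (P.B₂ v.2.1 - P.c) - (v'.2.2 + σ • (P.B₂ v'.2.1 - P.c)) =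
        (v.2.2 - v'.2.2) + σ • P.B₂ (v.2.1 - v'.2.1) := by
      simp only [map_sub]; module
    rw [e, mul_assoc]
    refine mul_le_mul_of_nonneg_left ?_ hC₁
    have := norm_add_le (v.2.2 - v'.2.2) (σ • P.B₂ (v.2.1 - v'.2.1))
    rw [← Prod.fst_sub w]
    linarith
  have n1 := norm_nonneg (v.1 - v'.1)
  have n2 := norm_nonneg (v.2.1 - v'.2.1)
  have n3 := norm_nonneg (v.2.2 - v'.2.2)
  refine norm_prod_le_iff.2 ⟨?_, norm_prod_le_iff.2 ⟨?_, ?_⟩⟩ <;>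
  simp only [Prod.fst_sub, Prod.snd_sub] <;> linarith

/-- A step is firmly nonexpansive in the factored data. -/
theorem IsFactor.firm {S₁ : Y →ₗ[ℝ] Y} {S₂ : Z →ₗ[ℝ] Z}
    (hS₁ : IsConvexityModulus P.f₁ S₁) (hS₂ : IsConvexityModulus P.f₂ S₂) (hσ : 0 < σ)
    (hR : P.IsFactor T₁ T₂ σ R) {w w' v v' : Y × Z × X} (h : P.IsStep T₁ T₂ σ w v)
    (h' : P.IsStep T₁ T₂ σ w' v') :
    0 ≤ ⟪R v - R v', (R w - R w') - (R v - R v')⟫_ℝ := by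
  have m1 := (sqSeminorm_nonneg hS₁.isPositive _).trans
    (hS₁.monotone _ h.y.1 _ h'.y.1 _ h.y _ h'.y)
  have hz := h.z
  have hz' := h'.z
  rw [h.smoothGrad_z] at hz
  rw [h'.smoothGrad_z] at hz'
  have m2 := (sqSeminorm_nonneg hS₂.isPositive _).trans
    (hS₂.monotone _ hz.1 _ hz'.1 _ hz _ hz')
  simp only [← map_sub]
  rw [hR]
  have e1 : -smoothGrad P.B₁ T₁ σ v.2.2 (P.B₂ v.2.1 - P.c) w.1 v.1
      - -smoothGrad P.B₁ T₁ σ v'.2.2 (P.B₂ v'.2.1 - P.c) w'.1 v'.1 =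
      -LinearMap.adjoint P.B₁ ((v - v').2.2
        + σ • (P.B₁ (v - v').1 + P.B₂ (v - v').2.1)) + T₁ ((w - w') - (v - v')).1 := by
    unfold smoothGrad
    simp only [Prod.fst_sub, Prod.snd_sub, map_add, map_sub, map_smul]
    module
  have e2 : -(LinearMap.adjoint P.B₂ v.2.2 + T₂ (v.2.1 - w.2.1))
      - -(LinearMap.adjoint P.B₂ v'.2.2 + T₂ (v'.2.1 - w'.2.1)) =
      -LinearMap.adjoint P.B₂ (v - v').2.2 + T₂ ((w - w') - (v - v')).2.1 := by
    simp only [Prod.fst_sub, Prod.snd_sub, map_sub]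
    module
  -- The multiplier update turns the third block of the residual into the feasibility defect of the
  -- difference `v - v'`; it then cancels against the `B₁`, `B₂` terms of `m1` and `m2`, scaled by
  -- `σ`.
  have e3 : σ • P.B₁ ((w - w') - (v - v')).1 + ((w - w') - (v - v')).2.2 =
      -(σ • (P.B₁ (v - v').1 + P.B₂ (v - v').2.1)) := by
    simp only [Prod.fst_sub, Prod.snd_sub, h.x, h'.x, map_sub]
    module
  rw [e1, inner_add_left, inner_neg_left, LinearMap.adjoint_inner_left, ← Prod.fst_sub v] at m1
  rw [e2, inner_add_left, inner_neg_left, LinearMap.adjoint_inner_left, ← Prod.fst_sub v.2,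
    ← Prod.snd_sub v] at m2
  rw [e3]
  generalize v - v' = d at *
  generalize (w - w') - d = g at *
  have m1' := mul_nonneg hσ.le m1
  have m2' := mul_nonneg hσ.le m2
  rw [real_inner_comm] at m1' m2'
  simp only [inner_add_left, inner_add_right, inner_smul_left, inner_smul_right, inner_neg_right,
    conj_trivial] at m1' m2' ⊢
  have c1 := real_inner_comm (T₁ g.1) d.1
  have c2 := real_inner_comm (T₂ g.2.1) d.2.1
  have c3 := real_inner_comm (P.B₁ d.1) (P.B₂ d.2.1)
  have c4 := real_inner_comm (P.B₁ d.1) d.2.2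
  have c5 := real_inner_comm (P.B₂ d.2.1) d.2.2
  nlinarith

/-- If `R` does not see the move from `w` to `v`, both proximal terms vanish, and with the
multiplier update the third block forces `v` to be feasible. The optimality conditions of the step
then become the KKT system. -/
theorem IsFactor.isKKT_of_eq (hT₁ : T₁.IsPositive) (hT₂ : T₂.IsPositive) (hσ : 0 < σ)
    (hR : P.IsFactor T₁ T₂ σ R) {w v : Y × Z × X}
    (h : P.IsStep T₁ T₂ σ w v) (hw : R v = R w) : P.IsKKT v.1 v.2.1 v.2.2 := by
  obtain ⟨C, hC, hT⟩ := hR.exists_norm_le hT₁ hT₂ hσ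
  obtain ⟨t1, t2, t3⟩ := hT (v - w)
  rw [map_sub, hw, sub_self, norm_zero] at t1 t2 t3
  rw [mul_zero] at t1 t2
  have t1 := norm_le_zero_iff.1 t1
  have t2 := norm_le_zero_iff.1 t2
  have t3 := norm_le_zero_iff.1 t3
  rw [Prod.fst_sub] at t1 t3
  rw [Prod.snd_sub, Prod.fst_sub] at t2
  rw [Prod.snd_sub, Prod.snd_sub] at t3
  have hfeas : P.B₁ v.1 + P.B₂ v.2.1 - P.c = 0 := by
    have e : σ • (P.B₁ v.1 + P.B₂ v.2.1 - P.c) = 0 := by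
      rw [← t3, h.x, map_sub]
      module
    exact (smul_eq_zero.1 e).resolve_left hσ.ne'
  refine ⟨?_, ?_, hfeas⟩
  · have := h.y
    rwa [smoothGrad, ← add_sub_assoc, hfeas, t1, smul_zero, add_zero, add_zero] at this
  · have := h.z
    rwa [h.smoothGrad_z, t2, add_zero] at this

end Factor

/-! ### Running the algorithm and convergence -/

/-- One step of the pADMM can always be performed. -/
theorem exists_step_min {S₁ : Y →ₗ[ℝ] Y} {S₂ : Z →ₗ[ℝ] Z}
    (hf₁ : ProperClosedConvex P.f₁) (hf₂ : ProperClosedConvex P.f₂)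
    (hS₁ : IsConvexityModulus P.f₁ S₁) (hS₂ : IsConvexityModulus P.f₂ S₂)
    (hT₁ : T₁.IsPositive) (hT₂ : T₂.IsPositive) (hσ : 0 < σ)
    (hKKT : ∃ y z x, P.IsKKT y z x)
    (hPD₁ : PosDef (S₁ + LinearMap.adjoint P.B₁ ∘ₗ P.B₁ + T₁))
    (hPD₂ : PosDef (S₂ + LinearMap.adjoint P.B₂ ∘ₗ P.B₂ + T₂)) (w : Y × Z × X) :
    ∃ wbar : Y × Z × X,
      (∀ z, P.zObjective T₂ σ w.1 w.2.1 w.2.2 wbar.2.1 ≤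
        P.zObjective T₂ σ w.1 w.2.1 w.2.2 z) ∧
      wbar.2.2 = w.2.2 + σ • (P.B₁ w.1 + P.B₂ wbar.2.1 - P.c) ∧
      ∀ y, P.yObjective T₁ σ w.1 wbar.2.1 wbar.2.2 wbar.1 ≤
        P.yObjective T₁ σ w.1 wbar.2.1 wbar.2.2 y := by
  obtain ⟨y, z, x, hk⟩ := hKKT
  obtain ⟨zb, hzb⟩ := exists_subproblem_min hf₂ hS₂ hT₂ hPD₂ hσ hk.2.1 w.2.2
    (P.B₁ w.1 - P.c) w.2.1
  obtain ⟨yb, hyb⟩ := exists_subproblem_min hf₁ hS₁ hT₁ hPD₁ hσ hk.1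
    (w.2.2 + σ • (P.B₁ w.1 + P.B₂ zb - P.c)) (P.B₂ zb - P.c) w.1
  refine ⟨(yb, zb, w.2.2 + σ • (P.B₁ w.1 + P.B₂ zb - P.c)), ?_, rfl, ?_⟩
  · simpa only [zObjective_eq] using hzb
  · simpa only [yObjective_eq] using hyb

theorem exists_isAccPADMM (P : Problem Y Z X) (T₁ : Y →ₗ[ℝ] Y) (T₂ : Z →ₗ[ℝ] Z)
    (σ α ρ : ℝ) (w₀ : Y × Z × X)
    (hstep : ∀ w : Y × Z × X, ∃ wbar : Y × Z × X,
      (∀ z, P.zObjective T₂ σ w.1 w.2.1 w.2.2 wbar.2.1 ≤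
        P.zObjective T₂ σ w.1 w.2.1 w.2.2 z) ∧
      wbar.2.2 = w.2.2 + σ • (P.B₁ w.1 + P.B₂ wbar.2.1 - P.c) ∧
      ∀ y, P.yObjective T₁ σ w.1 wbar.2.1 wbar.2.2 wbar.1 ≤
        P.yObjective T₁ σ w.1 wbar.2.1 wbar.2.2 y) :
    ∃ w what wbar : ℕ → Y × Z × X, P.IsAccPADMM T₁ T₂ σ α ρ w₀ w what wbar := by
  choose W hWz hWx hWy using hstep
  let next : ℕ → (Y × Z × X) × (Y × Z × X) → (Y × Z × X) × (Y × Z × X) := fun k s =>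
    (s.1 + (α / (2 * ((k : ℝ) + α))) • ((1 - ρ) • s.1 + ρ • W s.1 - s.1)
      + ((k : ℝ) / ((k : ℝ) + α)) • ((1 - ρ) • s.1 + ρ • W s.1 - s.2),
      (1 - ρ) • s.1 + ρ • W s.1)
  let s : ℕ → (Y × Z × X) × (Y × Z × X) := fun n => Nat.rec (w₀, w₀) next n
  exact ⟨fun k => (s k).1, fun k => (s k).2, fun k => W (s k).1,
    { init := rfl
      init_hat := rfl
      step_z := fun k => hWz _
      step_x := fun k => hWx _
      step_y := fun k => hWy _
      step_hat := fun k => rfl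
      step_w := fun k => rfl }⟩

/-- The accelerated iteration, driven by steps of the pADMM, converges to a KKT point. -/
theorem IsFactor.exists_tendsto_isKKT {H : Type*} [NormedAddCommGroup H] [InnerProductSpace ℝ H]
    [FiniteDimensional ℝ H] {R : (Y × Z × X) →ₗ[ℝ] H} (hsurj : Function.Surjective R)
    {S₁ : Y →ₗ[ℝ] Y} {S₂ : Z →ₗ[ℝ] Z}
    (hS₁ : IsConvexityModulus P.f₁ S₁) (hS₂ : IsConvexityModulus P.f₂ S₂)
    (hT₁ : T₁.IsPositive) (hT₂ : T₂.IsPositive) (hσ : 0 < σ)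
    (hPD₁ : PosDef (S₁ + LinearMap.adjoint P.B₁ ∘ₗ P.B₁ + T₁))
    (hPD₂ : PosDef (S₂ + LinearMap.adjoint P.B₂ ∘ₗ P.B₂ + T₂))
    (hKKT : ∃ y z x, P.IsKKT y z x) (hR : P.IsFactor T₁ T₂ σ R)
    (hstep : ∀ v, ∃ b, P.IsStep T₁ T₂ σ v b) {α ρ : ℝ} (hα : 2 ≤ α) (hρ : 0 < ρ) (hρ' : ρ ≤ 2)
    {w what wbar : ℕ → Y × Z × X} (hwbar : ∀ k, P.IsStep T₁ T₂ σ (w k) (wbar k))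
    (hhat : ∀ k, what (k + 1) = (1 - ρ) • w k + ρ • wbar k)
    (hw : ∀ k : ℕ, w (k + 1) = w k + (α / (2 * ((k : ℝ) + α))) • (what (k + 1) - w k)
      + ((k : ℝ) / ((k : ℝ) + α)) • (what (k + 1) - what k)) :
    ∃ v : Y × Z × X, Filter.Tendsto wbar Filter.atTop (nhds v) ∧
      P.IsKKT v.1 v.2.1 v.2.2 := by
  obtain ⟨C, hC⟩ := hR.exists_lipschitz hS₁ hS₂ hT₁ hT₂ hσ hPD₁ hPD₂
  choose W hW using hstep
  choose pre hpre using hsurj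
  -- The preimage is arbitrary; `hNR` shows that it does not matter, since the Lipschitz estimate
  -- makes steps from points with the same image coincide.
  let N : H → H := fun h => (1 - ρ) • h + ρ • R (W (pre h))
  have hN : ∀ a b, ‖N a - N b‖ ≤ ‖a - b‖ := by
    intro a b
    have e : N a - N b = (1 - ρ) • (a - b) + ρ • (R (W (pre a)) - R (W (pre b))) := by
      simp only [N]; module
    rw [e]
    refine norm_relax_le ?_ hρ.le hρ'
    have := hR.firm hS₁ hS₂ hσ (hW (pre a)) (hW (pre b))
    rwa [hpre, hpre] at this
  have hNR : ∀ {v b}, P.IsStep T₁ T₂ σ v b → N (R v) = (1 - ρ) • R v + ρ • R b := by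
    intro v b h
    have h1 := hC _ _ _ _ (hW (pre (R v))) h
    rw [hpre, sub_self, norm_zero, mul_zero] at h1
    simp only [N, sub_eq_zero.1 (norm_le_zero_iff.1 h1)]
  have hfix : ∃ p, N p = p := by
    obtain ⟨y, z, x, hk⟩ := hKKT
    refine ⟨R (y, z, x), ?_⟩
    rw [hNR (IsKKT.isStep (w := (y, z, x)) hk)]
    module
  obtain ⟨p, hp, hlim⟩ := accelerated_tendsto hN hfix hα
    (u := fun k => R (w k)) (uhat := fun k => R (what k))
    (fun k => by rw [hNR (hwbar k), hhat k, map_add, map_smul, map_smul])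
    (fun k => by rw [hw k]; simp only [map_add, map_smul, map_sub])
  have hRW : R (W (pre p)) = p := by
    have e : ρ • (R (W (pre p)) - p) = 0 := by
      have : (1 - ρ) • p + ρ • R (W (pre p)) = p := hp
      linear_combination (norm := module) this
    exact sub_eq_zero.1 ((smul_eq_zero.1 e).resolve_left hρ.ne')
  refine ⟨W (pre p), ?_, hR.isKKT_of_eq hT₁ hT₂ hσ (hW (pre p)) (hRW.trans (hpre p).symm)⟩
  rw [tendsto_iff_norm_sub_tendsto_zero] at hlim ⊢
  refine squeeze_zero (fun _ => norm_nonneg _) (fun k => hC _ _ _ _ (hwbar k) (hW (pre p))) ?_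
  rw [hpre p]
  simpa using hlim.const_mul C

end Problem

end AccPADMM

theorem mainTheorem6 {Y Z X : Type*}
    [NormedAddCommGroup Y] [InnerProductSpace ℝ Y] [FiniteDimensional ℝ Y]
    [NormedAddCommGroup Z] [InnerProductSpace ℝ Z] [FiniteDimensional ℝ Z]
    [NormedAddCommGroup X] [InnerProductSpace ℝ X] [FiniteDimensional ℝ X]
    (P : AccPADMM.Problem Y Z X)
    (hf₁ : AccPADMM.ProperClosedConvex P.f₁) (hf₂ : AccPADMM.ProperClosedConvex P.f₂)
    -- the operators `Σ_{f₁}` and `Σ_{f₂}`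
    (S₁ : Y →ₗ[ℝ] Y) (S₂ : Z →ₗ[ℝ] Z)
    (hS₁ : AccPADMM.IsConvexityModulus P.f₁ S₁) (hS₂ : AccPADMM.IsConvexityModulus P.f₂ S₂)
    -- the input of the algorithm
    (T₁ : Y →ₗ[ℝ] Y) (T₂ : Z →ₗ[ℝ] Z) (hT₁ : T₁.IsPositive) (hT₂ : T₂.IsPositive)
    (σ α ρ : ℝ) (hσ : 0 < σ) (hα : 2 ≤ α) (hρ : 0 < ρ) (hρ' : ρ ≤ 2)
    (w₀ : Y × Z × X)
    (hy₀ : w₀.1 ∈ AccPADMM.effDom P.f₁) (hz₀ : w₀.2.1 ∈ AccPADMM.effDom P.f₂)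
    -- the KKT system has a solution
    (hKKT : ∃ y z x, P.IsKKT y z x)
    -- positive definiteness
    (hPD₁ : AccPADMM.PosDef (S₁ + LinearMap.adjoint P.B₁ ∘ₗ P.B₁ + T₁))
    (hPD₂ : AccPADMM.PosDef (S₂ + LinearMap.adjoint P.B₂ ∘ₗ P.B₂ + T₂)) :
    -- the algorithm can be run
    (∃ w what wbar : ℕ → Y × Z × X, P.IsAccPADMM T₁ T₂ σ α ρ w₀ w what wbar) ∧
    -- and the sequence that it generates converges to a solution
    ∀ w what wbar : ℕ → Y × Z × X, P.IsAccPADMM T₁ T₂ σ α ρ w₀ w what wbar →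
      ∃ (ystar : Y) (zstar : Z) (xstar : X),
        Filter.Tendsto wbar Filter.atTop (nhds (ystar, zstar, xstar)) ∧
        P.IsPrimalSolution ystar zstar ∧ P.IsDualSolution xstar := by
  have hmin := AccPADMM.Problem.exists_step_min hf₁ hf₂ hS₁ hS₂ hT₁ hT₂ hσ hKKT hPD₁ hPD₂
  refine ⟨P.exists_isAccPADMM T₁ T₂ σ α ρ w₀ hmin, fun w what wbar hw => ?_⟩
  obtain ⟨n, m, R, hR⟩ := P.exists_isFactor hT₁ hT₂ hσ
  -- Restricting to the range makes `R` surjective, so that `N` is defined on the whole space.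
  have hR' : P.IsFactor (H := LinearMap.range R) T₁ T₂ σ R.rangeRestrict := fun w w' => hR w w'
  obtain ⟨v, hv, hk⟩ := hR'.exists_tendsto_isKKT R.surjective_rangeRestrict hS₁ hS₂ hT₁ hT₂ hσ
    hPD₁ hPD₂ hKKT
    (fun v => (hmin v).imp fun b hb =>
      AccPADMM.Problem.isStep_of_min hf₁ hf₂ hT₁ hT₂ hb.1 hb.2.1 hb.2.2) hα hρ hρ'
    (fun k => AccPADMM.Problem.isStep_of_min hf₁ hf₂ hT₁ hT₂ (hw.step_z k) (hw.step_x k)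
      (hw.step_y k)) hw.step_hat hw.step_w
  exact ⟨_, _, _, hv, hk.isPrimalSolution, hk.isDualSolution hf₁ hf₂⟩
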